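/- **Setting.** All logarithms are natural. Let $P,\sigma>0$, $\mathsf{snr}=P/\sigma^2$, $\mathcal C_\alpha=\frac12\log(1+\alpha\,\mathsf{snr})$ and $\mathcal C=\mathcal C_1$. Let $A$ be an $n\times ML$ design matrix with i.i.d. $\mathcal N(0,1/n)$ entries, its columns being divided into $L$ sections of $M$ columns. The message set $\mathcal B_{M,L}$ consists of the $M^L$ vectors $\beta\in\mathbb R^{ML}$ with exactly one non-zero entry in each section, equal to $\sqrt{nP/L}$. The channel output is $y=A\beta+w$, where $w$ is independent of $A$ and has i.i.d. $\mathcal N(0,\sigma^2)$ entries. An optimal decoder returns $\hat\beta\in\arg\min_{\beta'\in\mathcal B_{M,L}}\|y-A\beta'\|^2$ (ties broken arbitrarily), and the section error rate $\mathcal E_{\mathsf{sec}}$ is the fraction of sections in which $\hat\beta$ and $\beta$ differ. The rate $R$ is defined by $L\log M=nR$. Define the exponent $E(\epsilon,R)\in(-\infty,\infty]$ by $\mathbb P(\mathcal E_{\mathsf{sec}}\ge\epsilon)=e^{-nE(\epsilon,R)}$, the probability being over $A$, $w$ and a uniformly distributed $\beta\in\mathcal B_{M,L}$. Let $$D_1(x,v)=\max_{0\le\lambda\le1}\{\lambda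 x+\tfrac12\log(1-\lambda^2v)\},\qquad \mathsf a^*_L=\max_{\alpha\in\{\frac1L,\dots,1-\frac1L\}}\frac{R\log\binom{L}{L\alpha}}{D_1\!\left(\mathcal C_\alpha-\alpha\mathcal C,\frac{\alpha(1-\alpha)\mathsf{snr}}{1+\alpha\,\mathsf{snr}}\right)L\log L},$$ $$g(x)=\sqrt{1+4x^2}-1,\quad w(\mathsf{snr})=\frac{\mathsf{snr}}{2(1+\mathsf{snr})^2\sqrt{4+\mathsf{snr}^3/(1+\mathsf{snr})}},\quad h(\epsilon,\Delta)=\min\Big\{\epsilon\Delta\, w(\mathsf{snr}),\ \tfrac14\, g\Big(\frac{\Delta}{2\sqrt{\mathsf{snr}}}\Big)\Big\}.$$ **Proposition.** Suppose that $R<\mathcal C$, that $M=L^{\mathsf a}$ with $\mathsf a\ge\mathsf a^*_L$, that $M$ is a prime power and that $L\le M$. Let $\epsilon>0$. Then there is $k\le M$ with the following property. Take as outer code the systematic Reed–Solomon code of length $M$ and dimension $k$ over $GF(M)$ whose evaluation points are all the elements of $GF(M)$ (in any order), shortened to length $L$ by setting its first $M-L$ information symbols to $0$ (if $k<M-L$,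 all of them). Let the $\ell$-th remaining symbol of the outer codeword select, through any fixed bijection between $GF(M)$ and the $M$ columns, the column used in section $\ell$ of the SPARC. Decode with any optimal SPARC decoder followed by any minimum Hamming distance decoder of the shortened outer code. The resulting concatenated code has rate (logarithm of the number of its messages, divided by $n$) at least $R(1-2\epsilon)$ and at most $\max\{R(1-2\epsilon),0\}+R/L$, and its message error probability, averaged over the messages, $A$ and $w$, is at most $e^{-nE(\epsilon,R)}$, where $$E(\epsilon,R)\ \ge\ h(\epsilon,\mathcal C-R)-\frac{\log(2L)}{n}.$$ -/

import Mathlib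

open MeasureTheory ProbabilityTheory
open scoped ENNReal NNReal

noncomputable section

namespace Sparc

/-! ### Scalar quantities -/

/-- The channel capacity `(1/2) log (1 + snr)` (in nats) with `snr` scaled by `α`. -/
def capAt (snr α : ℝ) : ℝ := (1 / 2) * Real.log (1 + α * snr)

/-- The capacity of the AWGN channel, in nats per channel use. -/
def capacity (snr : ℝ) : ℝ := capAt snr 1

/-- `D₁(x, v) = max_{0 ≤ t ≤ 1} { t x + (1/2) log (1 - t² v) }`. -/
def D1 (x v : ℝ) : ℝ :=
  sSup ((fun t : ℝ => t * x + (1 / 2) * Real.log (1 - t ^ 2 * v)) '' Set.Icc 0 1)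

/-- `a*_L(snr)`: the maximum over `α = ℓ / L`, `1 ≤ ℓ ≤ L - 1`, of
`R log (L choose ℓ) / (D₁(C_α - α C, α (1 - α) snr / (1 + α snr)) L log L)`. -/
def aStar (L : ℕ) (R snr : ℝ) : ℝ :=
  sSup ((fun ℓ : ℕ =>
    R * Real.log (L.choose ℓ) /
      (D1 (capAt snr ((ℓ : ℝ) / L) - (ℓ : ℝ) / L * capacity snr)
          ((ℓ : ℝ) / L * (1 - (ℓ : ℝ) / L) * snr / (1 + (ℓ : ℝ) / L * snr))
        * L * Real.log L)) '' Set.Icc 1 (L - 1))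

/-- `g(x) = √(1 + 4x²) - 1`. -/
def gFun (x : ℝ) : ℝ := Real.sqrt (1 + 4 * x ^ 2) - 1

/-- `w(snr) = snr / (2 (1 + snr)² √(4 + snr³ / (1 + snr)))`. -/
def wFun (snr : ℝ) : ℝ :=
  snr / (2 * (1 + snr) ^ 2 * Real.sqrt (4 + snr ^ 3 / (1 + snr)))

/-- `h(ε, Δ) = min { ε Δ w(snr), (1/4) g(Δ / (2 √snr)) }`. -/
def hFun (snr ε Δ : ℝ) : ℝ :=
  min (ε * Δ * wFun snr) ((1 / 4) * gFun (Δ / (2 * Real.sqrt snr)))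

/-! ### The sparse regression code and the AWGN channel -/

/-- `n × ML` design matrices; column `(ℓ, j)` is the `j`-th column of section `ℓ`. -/
abbrev Design (n L M : ℕ) : Type := Fin n → Fin L × Fin M → ℝ

/-- The law of the design matrix: i.i.d. `N(0, 1/n)` entries. -/
def designMeasure (n L M : ℕ) : Measure (Design n L M) :=
  Measure.pi fun _ => Measure.pi fun _ => gaussianReal 0 ((n : ℝ≥0)⁻¹)

/-- The law of the channel noise: i.i.d. `N(0, σ²)` entries. -/
def noiseMeasure (n : ℕ) (σ : ℝ) : Measure (Fin n → ℝ) :=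
  Measure.pi fun _ => gaussianReal 0 (Real.toNNReal (σ ^ 2))

/-- Design matrix and channel noise are independent. -/
def channelMeasure (n L M : ℕ) (σ : ℝ) : Measure (Design n L M × (Fin n → ℝ)) :=
  (designMeasure n L M).prod (noiseMeasure n σ)

/-- The message vector with flat power allocation whose single non-zero entry in section `ℓ`
is in position `s ℓ` and equals `√(nP/L)`. The `M ^ L` index vectors `s` parametrize the set of
all valid message vectors. -/
def msgVec (n : ℕ) {L M : ℕ} (P : ℝ) (s : Fin L → Fin M) : Fin L × Fin M → ℝ :=
  fun j => if j.2 = s j.1 then Real.sqrt (n * P / L) else 0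

/-- The codeword `A β`. -/
def codeword {n L M : ℕ} (P : ℝ) (A : Design n L M) (s : Fin L → Fin M) : Fin n → ℝ :=
  Matrix.mulVec (Matrix.of A) (msgVec n P s)

/-- An optimal (maximum likelihood) decoder: for each design matrix `A` and channel output `y` it
returns a minimizer of `‖y - A β‖²` over all valid message vectors. Ties are broken
arbitrarily. -/
def IsOptimalDecoder {n L M : ℕ} (P : ℝ)
    (dec : Design n L M → (Fin n → ℝ) → (Fin L → Fin M)) : Prop :=
  ∀ (A : Design n L M) (y : Fin n → ℝ) (s : Fin L → Fin M),
    ∑ i, (y i - codeword P A (dec A y) i) ^ 2 ≤ ∑ i, (y i - codeword P A s i) ^ 2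

/-- The fraction of sections in which `t` differs from `s`. -/
def sectionErrorRate {L M : ℕ} (s t : Fin L → Fin M) : ℝ :=
  ((Finset.univ.filter fun ℓ => t ℓ ≠ s ℓ).card : ℝ) / L

/-- The probability that the section error rate is at least `ε`, averaged over the `M ^ L`
messages, the design matrix and the noise. -/
def excessErrorProb {n L M : ℕ} (P σ : ℝ)
    (dec : Design n L M → (Fin n → ℝ) → (Fin L → Fin M)) (ε : ℝ) : ℝ≥0∞ :=
  (∑ s : Fin L → Fin M, channelMeasure n L M σ
    {ω | ε ≤ sectionErrorRate s (dec ω.1 (codeword P ω.1 s + ω.2))}) / (M : ℝ≥0∞) ^ L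

/-- The exponent `E` defined by `ℙ(section error rate ≥ ε) = exp (-n E)`; it is `⊤` when the
probability is zero. -/
def errorExponent {n L M : ℕ} (P σ : ℝ)
    (dec : Design n L M → (Fin n → ℝ) → (Fin L → Fin M)) (ε : ℝ) : EReal :=
  -ENNReal.log (excessErrorProb P σ dec ε) / (n : EReal)

theorem exp_errorExponent {n L M : ℕ} (hn : n ≠ 0) (P σ : ℝ)
    (dec : Design n L M → (Fin n → ℝ) → (Fin L → Fin M)) (ε : ℝ) :
    EReal.exp (-((n : EReal) * errorExponent P σ dec ε)) = excessErrorProb P σ dec ε := by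
  unfold errorExponent
  rw [EReal.mul_div_cancel (EReal.natCast_ne_bot n) (EReal.natCast_ne_top n)
    (by exact_mod_cast hn), neg_neg, ENNReal.exp_log]

/-! ### The outer Reed–Solomon code -/

section RS

variable {F : Type*} [Field F]

/-- The systematic encoder of the `(N, k)` Reed–Solomon code with evaluation points `pts`: the
codeword consists of the values at all `N` points of the polynomial of degree less than `k` whose
values at the first `k` points are the information symbols. -/
def rsEncode {N k : ℕ} (hk : k ≤ N) (pts : Fin N → F) (u : Fin k → F) : Fin N → F :=
  fun i => (Lagrange.interpolate Finset.univ (fun j : Fin k => pts (Fin.castLE hk j)) u).eval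
    (pts i)

theorem rsEncode_systematic {N k : ℕ} (hk : k ≤ N) {pts : Fin N → F}
    (hpts : Function.Injective pts) (u : Fin k → F) (j : Fin k) :
    rsEncode hk pts u (Fin.castLE hk j) = u j :=
  Lagrange.eval_interpolate_at_node (s := Finset.univ)
    (v := fun j : Fin k => pts (Fin.castLE hk j)) u
    ((hpts.comp (Fin.castLE_injective hk)).injOn) (Finset.mem_univ j)

theorem rsEncode_eq_eval {N k : ℕ} (hk : k ≤ N) {pts : Fin N → F}
    (hpts : Function.Injective pts) (u : Fin k → F) :
    ∃ p : Polynomial F, p.degree < k ∧ ∀ i, rsEncode hk pts u i = p.eval (pts i) :=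
  ⟨Lagrange.interpolate Finset.univ (fun j : Fin k => pts (Fin.castLE hk j)) u, by
    have h := Lagrange.degree_interpolate_lt (s := Finset.univ)
      (v := fun j : Fin k => pts (Fin.castLE hk j)) u
      ((hpts.comp (Fin.castLE_injective hk)).injOn)
    rwa [Finset.card_univ, Fintype.card_fin] at h, fun _ => rfl⟩

/-- The systematic `(M, k)` Reed–Solomon code shortened to length `L`: the first `M - L`
information symbols are set to zero, the other `k - (M - L)` are the message `v`, and the last `L`
symbols of the codeword are kept. -/
def shortRS {L M k : ℕ} (hLM : L ≤ M) (hk : k ≤ M) (pts : Fin M → F)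
    (v : Fin (k - (M - L)) → F) : Fin L → F :=
  fun ℓ => rsEncode hk pts
    (fun i : Fin k => if h : M - L ≤ i.1 then v ⟨i.1 - (M - L), by omega⟩ else 0)
    ⟨M - L + ℓ.1, by omega⟩

/-- A minimum distance decoder for the code with encoder `enc`: it returns a message whose codeword
is nearest to the received word in Hamming distance. -/
def IsMinDistDecoder [DecidableEq F] {K L : ℕ} (enc : (Fin K → F) → (Fin L → F))
    (out : (Fin L → F) → (Fin K → F)) : Prop :=
  ∀ (r : Fin L → F) (v : Fin K → F), hammingDist r (enc (out r)) ≤ hammingDist r (enc v)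

/-- The rate, in nats per channel use, of a block code of length `n` with message set `F ^ K`. -/
def codeRate (F : Type*) [Fintype F] (n K : ℕ) : ℝ :=
  Real.log (Fintype.card (Fin K → F)) / n

/-- The message error probability of the concatenated code, averaged over the messages, the design
matrix and the noise. The message `v` is mapped to the outer codeword `enc v`, whose `ℓ`-th symbol
selects, through the bijection `lab` of field elements with column indices, the column in
section `ℓ`. The SPARC decoder `dec` produces an estimate of the column indices, and the outer
decoder `out` maps the corresponding symbols to a message. -/
def messageErrorProb [Fintype F] {n L M K : ℕ} (P σ : ℝ) (lab : F ≃ Fin M)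
    (enc : (Fin K → F) → (Fin L → F))
    (dec : Design n L M → (Fin n → ℝ) → (Fin L → Fin M))
    (out : (Fin L → F) → (Fin K → F)) : ℝ≥0∞ :=
  (∑ v : Fin K → F, channelMeasure n L M σ
    {ω | out (fun ℓ =>
        lab.symm (dec ω.1 (codeword P ω.1 (fun ℓ' => lab (enc v ℓ')) + ω.2) ℓ)) ≠ v}) /
    (Fintype.card (Fin K → F) : ℝ≥0∞)

end RS

end Sparc

end

open MeasureTheory ProbabilityTheory
open scoped ENNReal NNReal

noncomputable section

namespace Sparc

/-! The outer code is maximum distance separable: with `K = ⌈L(1-2ε)⌉` message symbols it corrects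
`d` symbol errors whenever `2d + K ≤ L`, which holds if fewer than `εL` sections are wrong. So a
message error forces a section error rate of at least `ε`. The outer code uses only some of the
`M^L` index vectors; but ties are null and the columns are exchangeable, so the probability of a
large section error rate is the same for every transmitted vector (`excessErrorProb_eq`), and the
averaged exponent applies to the subcode.

The exponent comes from a union bound over the number `l = αL` of wrong sections, each term being at
most `2 exp(-nh)`. For a fixed set of wrong sections, averaging over the competing columns with a
power `t ∈ [0,1]` (`random_coding_bound`) leaves an explicit exponential moment of a difference of
squares of two correlated Gaussians. Two reference variables are used: the noise
(`errEvent_le_untruncated`), and the noise plus `α` times the codeword (`errEvent_le_truncated`).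
The latter has a smaller residual variance, at the price of a second Chernoff term governed by a
threshold `τ`.

The condition on `a` gives `log (L choose l) ≤ n D₁`. At the tilt `t` maximizing `D₁` the refined
exponent therefore absorbs the number of error patterns and leaves `t(αΔ - τ)`, where `Δ = C - R`.
The choice `τ = αΔ/2` suffices unless `t` is small. For small tilts `exists_exponent_bound` mostly
returns to the unrefined bound, which keeps all of `tαΔ` up to a loss of order `t²α²s`. -/

/-! ### Scalar inequalities: `D1`, the concavity gap of the capacity, `gFun`. -/

lemma D1_le {x v b : ℝ}
    (h : ∀ t : ℝ, 0 ≤ t → t ≤ 1 → t * x + 1 / 2 * Real.log (1 - t ^ 2 * v) ≤ b) : D1 x v ≤ b := by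
  refine csSup_le (Set.Nonempty.image _ ⟨0, by simp⟩) ?_
  rintro _ ⟨t, ht, rfl⟩
  exact h t ht.1 ht.2

lemma log_le_log_add_div {a b : ℝ} (ha : 0 < a) (hb : 0 < b) :
    Real.log b ≤ Real.log a + (b - a) / a := by
  have h := Real.log_le_sub_one_of_pos (div_pos hb ha)
  rw [Real.log_div hb.ne' ha.ne'] at h
  have : b / a - 1 = (b - a) / a := by field_simp
  linarith

lemma one_sub_sq_mul_pos {t v : ℝ} (ht0 : 0 ≤ t) (ht1 : t ≤ 1) (hv0 : 0 ≤ v) (hv1 : v < 1) :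
    0 < 1 - t ^ 2 * v := by
  have : t ^ 2 ≤ 1 := by nlinarith
  nlinarith

/-- The objective is concave in the tilt, so a stationary point, or the endpoint 1, is a maximizer;
the tangent line of `log` there gives the global bound. The stationarity equation is kept because
`small_tilt_bounds` reads the size of the tilt off it. -/
lemma exists_D1_le {x v : ℝ} (hv0 : 0 ≤ v) (hv1 : v < 1) (hx : 0 ≤ x) :
    ∃ l : ℝ, 0 ≤ l ∧ l ≤ 1 ∧ D1 x v ≤ l * x + 1 / 2 * Real.log (1 - l ^ 2 * v) ∧
      (l = 1 ∨ x * (1 - l ^ 2 * v) = l * v) := by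
  rcases le_or_gt v (x * (1 - v)) with h | h
  · refine ⟨1, zero_le_one, le_rfl, D1_le fun t ht0 ht1 => ?_, Or.inl rfl⟩
    have h1 : 0 < 1 - v := by linarith
    have h2 := log_le_log_add_div (a := 1 - 1 ^ 2 * v) (by linarith)
      (one_sub_sq_mul_pos ht0 ht1 hv0 hv1)
    have h3 : (1 - t ^ 2 * v - (1 - 1 ^ 2 * v)) / (1 - 1 ^ 2 * v) = (1 - t ^ 2) * (v / (1 - v)) := by
      rw [one_pow, one_mul]; field_simp; ring
    have h4 : v / (1 - v) ≤ x := by rwa [div_le_iff₀ h1]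
    have h5 : 0 ≤ v / (1 - v) := by positivity
    rw [h3] at h2
    nlinarith [mul_nonneg (sub_nonneg.2 ht1) (sub_nonneg.2 h4), mul_nonneg h5 (sq_nonneg (1 - t))]
  · obtain ⟨l, ⟨hl0, hl1⟩, hl⟩ : ∃ l ∈ Set.Icc (0 : ℝ) 1, l * v - x * (1 - l ^ 2 * v) = 0 := by
      apply intermediate_value_Icc (zero_le_one' ℝ)
        (f := fun l : ℝ => l * v - x * (1 - l ^ 2 * v)) (by fun_prop)
      constructor <;> norm_num <;> linarith
    refine ⟨l, hl0, hl1, D1_le fun t ht0 ht1 => ?_, Or.inr (by linarith)⟩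
    have h1 := one_sub_sq_mul_pos hl0 hl1 hv0 hv1
    have h2 := log_le_log_add_div h1 (one_sub_sq_mul_pos ht0 ht1 hv0 hv1)
    have h3 : (1 - t ^ 2 * v - (1 - l ^ 2 * v)) / (1 - l ^ 2 * v)
        = (l ^ 2 - t ^ 2) * (v / (1 - l ^ 2 * v)) := by field_simp; ring
    have h4 : x = l * (v / (1 - l ^ 2 * v)) := by field_simp; linarith
    have h5 : 0 ≤ v / (1 - l ^ 2 * v) := by positivity
    rw [h3] at h2
    generalize v / (1 - l ^ 2 * v) = q at *
    subst h4
    nlinarith [mul_nonneg h5 (sq_nonneg (l - t))]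

lemma D1_le_sq_div {x v : ℝ} (hv0 : 0 < v) (hv1 : v < 1) : D1 x v ≤ x ^ 2 / (2 * v) := by
  refine D1_le fun t ht0 ht1 => ?_
  have h := Real.log_le_sub_one_of_pos (one_sub_sq_mul_pos ht0 ht1 hv0.le hv1)
  have : x ^ 2 / (2 * v) - (t * x - t ^ 2 * v / 2) = (x - t * v) ^ 2 / (2 * v) := by
    field_simp; ring
  have : 0 ≤ (x - t * v) ^ 2 / (2 * v) := by positivity
  linarith

/-- This is `y ≤ sinh y` at `y = log (1 + z)`. -/
lemma log_one_add_le {z : ℝ} (hz : 0 ≤ z) :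
    Real.log (1 + z) ≤ z * (2 + z) / (2 * (1 + z)) := by
  have h : Real.log (1 + z) ≤ Real.sinh (Real.log (1 + z)) :=
    Real.self_le_sinh_iff.2 (Real.log_nonneg (by linarith))
  rw [Real.sinh_log (by linarith)] at h
  refine h.trans (le_of_eq ?_)
  field_simp; ring

lemma sub_half_sq_le_log {z : ℝ} (hz : 0 ≤ z) : z - z ^ 2 / 2 ≤ Real.log (1 + z) := by
  refine le_trans ?_ (Real.le_log_one_add_of_nonneg hz)
  rw [le_div_iff₀ (by linarith)]
  nlinarith [pow_nonneg hz 3]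

/-- Lower bound on the concavity gap of the capacity function. -/
lemma capAt_sub_ge {s α : ℝ} (hs : 0 < s) (h0 : 0 ≤ α) (h1 : α ≤ 1) :
    s / (4 * (1 + s)) * (α * (1 - α) * s / (1 + α * s)) ≤ capAt s α - α * capacity s := by
  have hz : 0 ≤ α * s := by positivity
  have hu : 0 ≤ (1 - α) * s / (1 + α * s) := div_nonneg (mul_nonneg (by linarith) hs.le) (by linarith)
  have h2 := Real.le_log_one_add_of_nonneg hz
  have h3 := log_one_add_le hu
  -- With `u = (1-α)s/(1+αs)` the gap becomes `½((1-α) log(1+αs) - α log(1+u))`, so one lower and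
  -- one upper bound for a logarithm suffice.
  have h4 : Real.log (1 + s) = Real.log (1 + α * s) + Real.log (1 + (1 - α) * s / (1 + α * s)) := by
    rw [← Real.log_mul (by linarith) (by linarith)]
    congr 1; field_simp; ring
  have h5 : (1 - α) * s / (1 + α * s) * (2 + (1 - α) * s / (1 + α * s)) /
      (2 * (1 + (1 - α) * s / (1 + α * s)))
      = (1 - α) * s * (2 + s + α * s) / (2 * (1 + α * s) * (1 + s)) := by
    have : 1 + (1 - α) * s / (1 + α * s) = (1 + s) / (1 + α * s) := by field_simp; ring
    rw [this]; field_simp; ring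
  rw [h5] at h3
  unfold capacity capAt
  rw [one_mul, h4]
  have h6 : 0 ≤ α * (1 - α) * s * (2 / (α * s + 2) -
      (2 + s + α * s) / (2 * (1 + α * s) * (1 + s)) - s / (2 * (1 + s) * (1 + α * s))) := by
    apply mul_nonneg (mul_nonneg (mul_nonneg h0 (by linarith)) hs.le)
    have : 2 / (α * s + 2) - (2 + s + α * s) / (2 * (1 + α * s) * (1 + s))
        - s / (2 * (1 + s) * (1 + α * s))
        = (α * s * s * (2 - α)) / (2 * (1 + s) * (1 + α * s) * (α * s + 2)) := by
      field_simp; ring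
    rw [this]
    have : 0 ≤ 2 - α := by linarith
    positivity
  have h7 := mul_le_mul_of_nonneg_left h2 (sub_nonneg.2 h1)
  have h8 := mul_le_mul_of_nonneg_left h3 h0
  have e1 : s / (4 * (1 + s)) * (α * (1 - α) * s / (1 + α * s))
    = 1 / 2 * (α * (1 - α) * s * (s / (2 * (1 + s) * (1 + α * s)))) := by field_simp; ring
  have e2 : (1 - α) * (2 * (α * s) / (α * s + 2)) = α * (1 - α) * s * (2 / (α * s + 2)) := by ring
  have e3 : α * ((1 - α) * s * (2 + s + α * s) / (2 * (1 + α * s) * (1 + s)))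
    = α * (1 - α) * s * ((2 + s + α * s) / (2 * (1 + α * s) * (1 + s))) := by ring
  rw [e1]; rw [e2] at h7; rw [e3] at h8
  nlinarith

/-- The witness is the exact maximizer: with `u = t/√v`, stationarity is `u(1 - m²v) = m√v`, hence
`m√v = g(u)/(2u)`. There `mt = g/2` and `1 - m²v = (1 + g/2)⁻¹`, and `log(1 + g/2) ≤ g/2` leaves
`g/4`. The tilt may exceed 1, since it serves a plain Chernoff bound. -/
lemma exists_tilt_gFun {t v : ℝ} (ht : 0 < t) (hv : 0 < v) :
    ∃ m : ℝ, 0 ≤ m ∧ m ^ 2 * v < 1 ∧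
      1 / 4 * gFun (t / Real.sqrt v) ≤ m * t + 1 / 2 * Real.log (1 - m ^ 2 * v) := by
  have hr := Real.sqrt_pos.2 hv
  set u := t / Real.sqrt v with hu
  have hu0 : 0 < u := by positivity
  have hq : Real.sqrt (1 + 4 * u ^ 2) ^ 2 = 1 + 4 * u ^ 2 := Real.sq_sqrt (by positivity)
  have hq1 : 1 < Real.sqrt (1 + 4 * u ^ 2) := Real.lt_sqrt_of_sq_lt (by nlinarith [sq_pos_of_pos hu0])
  set g := gFun u with hg
  have hgq : Real.sqrt (1 + 4 * u ^ 2) = g + 1 := by rw [hg, gFun]; ring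
  rw [hgq] at hq hq1
  have hg0 : 0 < g := by linarith
  have htu : t = u * Real.sqrt v := by rw [hu]; field_simp
  refine ⟨g / (2 * u * Real.sqrt v), by positivity, ?_, ?_⟩
  · have : (g / (2 * u * Real.sqrt v)) ^ 2 * v = g ^ 2 / (4 * u ^ 2) := by
      rw [div_pow, mul_pow, Real.sq_sqrt hv.le]; field_simp; ring
    rw [this, div_lt_one (by positivity)]; nlinarith
  · have h1 : (g / (2 * u * Real.sqrt v)) ^ 2 * v = 1 - (1 + g / 2)⁻¹ := by
      have : (g / (2 * u * Real.sqrt v)) ^ 2 * v = g ^ 2 / (4 * u ^ 2) := by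
        rw [div_pow, mul_pow, Real.sq_sqrt hv.le]; field_simp; ring
      rw [this, show 4 * u ^ 2 = g * (g + 2) by nlinarith]; field_simp; ring
    have h2 : g / (2 * u * Real.sqrt v) * t = g / 2 := by rw [htu]; field_simp
    rw [h1, h2, sub_sub_cancel, Real.log_inv]
    have := Real.log_le_sub_one_of_pos (show 0 < 1 + g / 2 by linarith)
    linarith

lemma gFun_mono {x y : ℝ} (hx : 0 ≤ x) (hxy : x ≤ y) : gFun x ≤ gFun y := by
  unfold gFun; gcongr

lemma gFun_le (x : ℝ) : gFun x ≤ 2 * x ^ 2 := by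
  unfold gFun
  have : Real.sqrt (1 + 4 * x ^ 2) ≤ 1 + 2 * x ^ 2 := Real.sqrt_le_iff.2 ⟨by positivity, by nlinarith [sq_nonneg (x ^ 2)]⟩
  linarith

lemma wFun_le {s : ℝ} (hs : 0 < s) : wFun s ≤ s / (4 * (1 + s) ^ 2) := by
  unfold wFun
  have : 2 ≤ Real.sqrt (4 + s ^ 3 / (1 + s)) :=
    Real.le_sqrt_of_sq_le (by have : 0 ≤ s ^ 3 / (1 + s) := by positivity
                              linarith)
  apply div_le_div_of_nonneg_left hs.le (by positivity)
  nlinarith [sq_nonneg (1 + s)]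

/-- `hB` cancels the binomial coefficient and leaves `l(αΔ - t)` in the first term. Taking the
threshold `t = αΔ/2` keeps half of it, and `exists_tilt_gFun` then yields the `gFun` part of `h`
from the second term, because `√(α²s/(1+α²s)) ≤ α√s`. -/
lemma exists_truncation {s α Δ x n B l h v : ℝ} (hs : 0 < s) (hα : 0 < α) (hΔ : 0 < Δ)
    (hn : 0 ≤ n) (hB : B ≤ n * (l * x + 1 / 2 * Real.log (1 - l ^ 2 * v)))
    (h1 : h ≤ l * α * Δ / 2) (h2 : h ≤ 1 / 4 * gFun (Δ / (2 * Real.sqrt s))) :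
    ∃ m t : ℝ, 0 ≤ m ∧ m ^ 2 * (α ^ 2 * s / (1 + α ^ 2 * s)) < 1 ∧
      Real.exp B * Real.exp (-(n * (l * (x + α * Δ - t) + 1 / 2 * Real.log (1 - l ^ 2 * v)))) +
        Real.exp (-(n * (m * t + 1 / 2 * Real.log (1 - m ^ 2 * (α ^ 2 * s / (1 + α ^ 2 * s))))))
      ≤ 2 * Real.exp (-(n * h)) := by
  have hr := Real.sqrt_pos.2 hs
  have hv : 0 < α ^ 2 * s / (1 + α ^ 2 * s) := by positivity
  obtain ⟨m, hm0, hm1, hm⟩ := exists_tilt_gFun (t := α * Δ / 2) (by positivity) hv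
  refine ⟨m, α * Δ / 2, hm0, hm1, ?_⟩
  have h3 : Real.sqrt (α ^ 2 * s / (1 + α ^ 2 * s)) ≤ α * Real.sqrt s := by
    rw [Real.sqrt_le_left (by positivity), mul_pow, Real.sq_sqrt hs.le]
    exact div_le_self (by positivity) (by nlinarith [mul_pos (pow_pos hα 2) hs])
  have h4 : Δ / (2 * Real.sqrt s) ≤ α * Δ / 2 / Real.sqrt (α ^ 2 * s / (1 + α ^ 2 * s)) := by
    calc Δ / (2 * Real.sqrt s) = α * Δ / 2 / (α * Real.sqrt s) := by field_simp
      _ ≤ _ := by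
        apply div_le_div_of_nonneg_left (by positivity) (Real.sqrt_pos.2 hv) h3
  have h5 := gFun_mono (by positivity) h4
  have e1 : Real.exp B * Real.exp (-(n * (l * (x + α * Δ - α * Δ / 2) +
      1 / 2 * Real.log (1 - l ^ 2 * v)))) ≤ Real.exp (-(n * h)) := by
    rw [← Real.exp_add]
    apply Real.exp_le_exp.2
    nlinarith [mul_le_mul_of_nonneg_left h1 hn]
  have e2 : Real.exp (-(n * (m * (α * Δ / 2) +
      1 / 2 * Real.log (1 - m ^ 2 * (α ^ 2 * s / (1 + α ^ 2 * s)))))) ≤ Real.exp (-(n * h)) := by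
    apply Real.exp_le_exp.2
    apply neg_le_neg
    apply mul_le_mul_of_nonneg_left _ hn
    linarith
  linarith

lemma log_gap {p q : ℝ} (hp : p < 1) (hq : q < 1) :
    Real.log (1 - q) - (p - q) / (1 - p) ≤ Real.log (1 - p) := by
  have := log_le_log_add_div (a := 1 - p) (b := 1 - q) (by linarith) (by linarith)
  rw [show 1 - q - (1 - p) = p - q by ring] at this
  linarith

/-- Loss in the exponent when the reference term of the error event is not refined. -/
lemma untruncated_loss {s α l : ℝ} (hs : 0 < s) (hα0 : 0 < α) (hl0 : 0 ≤ l)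
    (hl : l ≤ 1 / 8) :
    Real.log (1 - l ^ 2 * (α * (1 - α) * s / (1 + α * s))) - 64 / 63 * (l ^ 2 * α ^ 2 * s) ≤
      Real.log (1 - l ^ 2 * (α * s / (1 + α * s))) := by
  have hp : 0 < 1 + α * s := by positivity
  set V := α * s / (1 + α * s) with hV
  have hV0 : 0 ≤ V := by positivity
  have hV1 : V ≤ 1 := by rw [hV, div_le_one hp]; linarith
  have hVs : V ≤ α * s := div_le_self (by positivity) (by nlinarith [mul_pos hα0 hs])
  have e : α * (1 - α) * s / (1 + α * s) = (1 - α) * V := by rw [hV]; ring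
  rw [e]
  -- The factor `64/63` is `1/(1 - 1/64)`.
  have hl2 : l ^ 2 ≤ 1 / 64 := by nlinarith
  have hlV : l ^ 2 * V ≤ 1 / 64 := by nlinarith [sq_nonneg l]
  have h := log_gap (p := l ^ 2 * V) (q := l ^ 2 * ((1 - α) * V)) (by linarith)
    (by nlinarith [mul_nonneg (mul_nonneg (sq_nonneg l) hV0) hα0.le])
  have h2 : (l ^ 2 * V - l ^ 2 * ((1 - α) * V)) / (1 - l ^ 2 * V) ≤ 64 / 63 * (l ^ 2 * α ^ 2 * s) := by
    rw [div_le_iff₀ (by linarith)]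
    have h3 : l ^ 2 * V - l ^ 2 * ((1 - α) * V) = l ^ 2 * α * V := by ring
    have h4 : l ^ 2 * α * V ≤ l ^ 2 * α * (α * s) := by gcongr
    have h5 : 0 ≤ l ^ 2 * α ^ 2 * s := by positivity
    nlinarith
  linarith

/-- Using a larger tilt when the gap to capacity and the error fraction are not small. -/
lemma larger_tilt {s α Δ x l w : ℝ} (hs : 0 < s) (hs1 : s < 1 / 10) (hα0 : 1 / 30 ≤ α)
    (hα1 : α ≤ 1) (hl0 : 0 ≤ l) (hl : l ≤ s / 2) (hwl : w ≤ l) (hΔ : 7 * s * α * l ≤ Δ)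
    (hx : l * (α * (1 - α) * s / (1 + α * s)) ≤ x) :
    α * Δ * w + (l * x + 1 / 2 * Real.log (1 - l ^ 2 * (α * (1 - α) * s / (1 + α * s)))) ≤
      l * (1 + 6 * α) * (x + α * Δ) +
        1 / 2 * Real.log (1 - (l * (1 + 6 * α)) ^ 2 * (α * s / (1 + α * s))) := by
  have hα : 0 < α := by linarith
  have hp : 0 < 1 + α * s := by positivity
  set V := α * s / (1 + α * s) with hV
  have hV0 : 0 ≤ V := by positivity
  have hVs : V ≤ α * s := div_le_self (by positivity) (by nlinarith [mul_pos hα hs])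
  have hV1 : V ≤ 1 / 10 := by nlinarith
  have e : α * (1 - α) * s / (1 + α * s) = (1 - α) * V := by rw [hV]; ring
  rw [e] at hx ⊢
  set k := l * (1 + 6 * α) with hk
  have hk0 : 0 ≤ k := by positivity
  have hk1 : k ≤ 7 / 20 := by
    calc k ≤ (1 / 20) * 7 := by
          apply mul_le_mul <;> linarith
      _ = _ := by norm_num
  have hk2 : k ^ 2 ≤ 49 / 400 := by nlinarith
  have hkV : k ^ 2 * V ≤ 49 / 4000 := by nlinarith [sq_nonneg k]
  have hl2 : l ^ 2 ≤ k ^ 2 := by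
    apply pow_le_pow_left₀ hl0; nlinarith
  have hlV : l ^ 2 * ((1 - α) * V) ≤ k ^ 2 * V := by
    apply mul_le_mul hl2 _ (mul_nonneg (by linarith) hV0) (sq_nonneg k)
    nlinarith
  have h := log_gap (p := k ^ 2 * V) (q := l ^ 2 * ((1 - α) * V)) (by linarith) (by linarith)
  have h2 : (k ^ 2 * V - l ^ 2 * ((1 - α) * V)) / (1 - k ^ 2 * V)
      ≤ 4000 / 3951 * (k ^ 2 * V - l ^ 2 * ((1 - α) * V)) := by
    rw [div_le_iff₀ (by linarith)]
    nlinarith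
  have h3 : k ^ 2 * V - l ^ 2 * ((1 - α) * V) = l ^ 2 * V * (13 * α + 36 * α ^ 2) := by rw [hk]; ring
  rw [h3] at h h2
  have h4 : (k - w) * (α * Δ) ≥ (6 * α * l) * (α * (7 * s * α * l)) := by
    apply mul_le_mul _ (by gcongr) (by positivity) _
    · rw [hk]; linarith
    · rw [hk]; nlinarith
  have h5 : (k - l) * x ≥ (6 * α * l) * (l * ((1 - α) * V)) := by
    have : k - l = 6 * α * l := by rw [hk]; ring
    rw [this]; gcongr
  have h6 : l ^ 2 * V * α * (2000 / 3951 * (13 + 36 * α) - 6 * (1 - α)) ≤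
      l ^ 2 * (α * s) * α * (2000 / 3951 * (13 + 36 * α) - 6 * (1 - α)) := by
    gcongr
    linarith
  -- `42 = 6 · 7` is the extra tilt `6αl` times `Δ ≥ 7sαl`. The inequality is nearly tight at `α =
  -- 1/30`, which explains that threshold.
  have h7 : 0 ≤ l ^ 2 * s * α ^ 2 * (42 * α - (2000 / 3951 * (13 + 36 * α) - 6 * (1 - α))) := by
    apply mul_nonneg (by positivity); linarith
  linarith

/-! ### Small fractions of wrong sections, and bounds for small tilts. -/

/-- Combine `2^l ≤ 2 l!` and `(l/e)^l ≤ l!` with weights `0.85` and `0.15`. The `log 2` is needed at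
`l = 1`; it is finally absorbed by the factor 2 in `2 exp(-nh)`. -/
lemma log_two_mul_factorial_ge {l : ℕ} (hl : 1 ≤ l) :
    (0.4 + 0.15 * Real.log l) * l ≤ Real.log 2 + Real.log (l.factorial) := by
  have hl0 : (0 : ℝ) < l := by exact_mod_cast hl
  have hf : (0 : ℝ) < l.factorial := by exact_mod_cast l.factorial_pos
  have h1 : (l : ℝ) * Real.log 2 ≤ Real.log 2 + Real.log l.factorial := by
    rw [← Real.log_mul (by norm_num) hf.ne', ← Real.log_pow]
    apply Real.log_le_log (by positivity)
    have : 2 ^ l ≤ 2 * l.factorial := by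
      induction l, hl using Nat.le_induction with
      | base => simp
      | succ k hk ih =>
        have := ih (by exact_mod_cast hk) (by exact_mod_cast k.factorial_pos)
        rw [pow_succ, Nat.factorial_succ]
        nlinarith
    exact_mod_cast this
  have h2 : (l : ℝ) * Real.log l - l ≤ Real.log l.factorial := by
    have := Real.pow_div_factorial_le_exp (l : ℝ) hl0.le l
    have h := Real.log_le_log (by positivity) this
    rw [Real.log_exp, Real.log_div (by positivity) hf.ne', Real.log_pow] at h
    linarith
  have := Real.log_two_gt_d9
  have h3 : 0 ≤ Real.log 2 := by linarith
  nlinarith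

/-- Binomial coefficients with a small fraction `l / L`. -/
lemma log_choose_le_of_small {L l : ℕ} (hl : 1 ≤ l) (hlL : 30 * l ≤ L) :
    Real.log (L.choose l) ≤ l * Real.log L * (1 - 3.33 * ((l : ℝ) / L)) + Real.log 2 := by
  have hl0 : (0 : ℝ) < l := by exact_mod_cast hl
  have hL0 : (0 : ℝ) < L := by exact_mod_cast (by omega : 0 < L)
  have hlL' : 30 * (l : ℝ) ≤ L := by exact_mod_cast hlL
  have hl1 : (0 : ℝ) ≤ Real.log l := Real.log_nonneg (by exact_mod_cast hl)
  have hf : (0 : ℝ) < l.factorial := by exact_mod_cast l.factorial_pos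
  have h1 : Real.log (L.choose l) ≤ l * Real.log L - Real.log (l.factorial) := by
    rw [← Real.log_pow, ← Real.log_div (by positivity) hf.ne']
    exact Real.log_le_log (by exact_mod_cast Nat.choose_pos (by omega)) (Nat.choose_le_pow_div l L)
  have h2 := log_two_mul_factorial_ge hl
  -- Tangent bound at `L = 30 l`; multiplied by `α = l/L`, its last term becomes a constant.
  have h3 : Real.log L ≤ Real.log l + 5 * Real.log 2 + (L / (30 * l) - 1) := by
    have h4 : Real.log 30 ≤ 5 * Real.log 2 := by
      rw [show (5 : ℝ) = (5 : ℕ) by norm_num, ← Real.log_pow]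
      apply Real.log_le_log <;> norm_num
    have h5 := Real.log_le_sub_one_of_pos (show (0 : ℝ) < L / (30 * l) by positivity)
    rw [Real.log_div (by positivity) (by positivity), Real.log_mul (by norm_num) (by positivity)] at h5
    linarith
  have h4 := Real.log_two_lt_d9
  set α : ℝ := (l : ℝ) / L with hα
  have hα0 : 0 < α := by positivity
  have hα1 : α ≤ 1 / 30 := by rw [hα, div_le_div_iff₀ hL0 (by norm_num)]; linarith
  have h5 : α * Real.log L ≤ 1 / 30 * Real.log l + 0.1156 := by
    calc α * Real.log L ≤ α * (Real.log l + 5 * Real.log 2 + (L / (30 * l) - 1)) := by gcongr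
      _ = α * Real.log l + α * (5 * Real.log 2 - 1) + 1 / 30 := by rw [hα]; field_simp; ring
      _ ≤ 1 / 30 * Real.log l + 1 / 30 * (5 * Real.log 2 - 1) + 1 / 30 := by
        gcongr
        have := Real.log_two_gt_d9; linarith
      _ ≤ _ := by linarith
  nlinarith

set_option maxHeartbeats 800000 in
/-- The exponent for a small fraction of section errors, compared with a single section error. -/
lemma small_fraction_exponent {s a q l : ℝ} (hs : 0 < s) (hs1 : s < 1 / 10) (ha : 0 < a)
    (hq : 1 ≤ q) (hqa : q * a ≤ 1 / 30)
    (hl : l = (capAt s a - a * capacity s) / (a * (1 - a) * s / (1 + a * s))) :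
    s / (4 * (1 + s)) ≤ l ∧ l ≤ 1 ∧
      q * ((capAt s a - a * capacity s) ^ 2 / (2 * (a * (1 - a) * s / (1 + a * s)))) *
          (1 - 3.33 * (q * a)) ≤
        l * (capAt s (q * a) - q * a * capacity s) +
          1 / 2 * Real.log (1 - l ^ 2 * (q * a * s / (1 + q * a * s))) := by
  have haq : a ≤ q * a := by nlinarith
  have ha1 : a ≤ 1 / 30 := by linarith
  have hp : 0 < 1 + a * s := by positivity
  have hge := capAt_sub_ge hs ha.le (by linarith : a ≤ 1)
  set v := a * (1 - a) * s / (1 + a * s) with hv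
  have hv0 : 0 < v := by
    have : 0 < 1 - a := by linarith
    positivity
  set x := capAt s a - a * capacity s with hx
  have hxl : x = l * v := by rw [hl]; field_simp
  have hl0 : s / (4 * (1 + s)) ≤ l := by rw [hl, le_div_iff₀ hv0]; exact hge
  have hl0' : 0 < l := lt_of_lt_of_le (by positivity) hl0
  have hC := sub_half_sq_le_log hs.le
  have hCa : Real.log (1 + a * s) ≤ a * s := by
    have := Real.log_le_sub_one_of_pos hp; linarith
  have hxle : x ≤ a * s ^ 2 / 4 := by
    rw [hx]; unfold capacity capAt; rw [one_mul]
    nlinarith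
  have hvge : a * s * (29 / 31) ≤ v := by
    rw [hv, le_div_iff₀ hp]
    have : (29 / 31 : ℝ) * (1 + a * s) ≤ 1 - a := by nlinarith
    calc a * s * (29 / 31) * (1 + a * s) = a * s * (29 / 31 * (1 + a * s)) := by ring
      _ ≤ a * s * (1 - a) := by gcongr
      _ = _ := by ring
  have hls : l ≤ s / 3 := by
    have : l * (a * s * (29 / 31)) ≤ a * s ^ 2 / 4 := by
      calc _ ≤ l * v := by gcongr
        _ ≤ _ := by linarith
    have h2 : l * (29 / 31) * (a * s) ≤ s / 4 * (a * s) := by nlinarith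
    have h3 := le_of_mul_le_mul_right h2 (by positivity)
    linarith
  refine ⟨hl0, by linarith, ?_⟩
  set α := q * a with hα
  have hα0 : 0 < α := by linarith
  have hpα : 0 < 1 + α * s := by positivity
  have hxα : q * x - α ^ 2 * s ^ 2 / 4 ≤ capAt s α - α * capacity s := by
    have h1 := sub_half_sq_le_log (z := α * s) (by positivity)
    have h2 : q * Real.log (1 + a * s) ≤ α * s := by
      rw [hα]; nlinarith
    rw [hx]; unfold capAt
    have : q * (a * capacity s) = α * capacity s := by rw [hα]; ring
    nlinarith
  have hxge : a * s ^ 2 / 4 * 0.875 ≤ x := by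
    refine le_trans ?_ hge
    have : s / (4 * (1 + s)) * v = a * s ^ 2 / 4 * ((1 - a) / ((1 + s) * (1 + a * s))) := by
      rw [hv]; field_simp
    rw [this]
    gcongr
    rw [le_div_iff₀ (by positivity)]
    have h1 : 1 + a * s ≤ 301 / 300 := by nlinarith
    have h2 : (1 + s) * (1 + a * s) ≤ 11 / 10 * (301 / 300) := by gcongr; linarith
    linarith
  have hquad : α ^ 2 * s ^ 2 / 4 ≤ 1.143 * (α * (q * x)) := by
    have : α ^ 2 * s ^ 2 / 4 = α * q * (a * s ^ 2 / 4) := by rw [hα]; ring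
    rw [this]
    have : 0 < α * q := by positivity
    nlinarith
  set V := α * s / (1 + α * s) with hV
  have hV0 : 0 ≤ V := by positivity
  have hVs : V ≤ α * s := div_le_self (by positivity) (by nlinarith [mul_pos hα0 hs])
  have hVv : V ≤ q * v * (1 + 1.035 * α) := by
    have h1 : V ≤ α * s / (1 + a * s) := by
      rw [hV]; gcongr
    have h2 : α * s / (1 + a * s) * (1 - a) = q * v := by rw [hv, hα]; ring
    have h3 : (1 : ℝ) ≤ (1 - a) * (1 + 1.035 * α) := by nlinarith
    have h4 : 0 ≤ α * s / (1 + a * s) := by positivity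
    rw [← h2]
    nlinarith
  have hl2 : l ^ 2 ≤ 1 / 900 := by nlinarith
  have hlV : l ^ 2 * V ≤ α / 9000 := by
    calc l ^ 2 * V ≤ 1 / 900 * (α * (1 / 10)) := by
          gcongr
          exact hVs.trans (by gcongr)
      _ = _ := by ring
  have hlog := log_gap (p := l ^ 2 * V) (q := 0) (by linarith) (by norm_num)
  rw [sub_zero, sub_zero, Real.log_one, zero_sub] at hlog
  have hfrac : l ^ 2 * V / (1 - l ^ 2 * V) ≤ q * (l ^ 2 * v) * (1 + 1.037 * α) := by
    rw [div_le_iff₀ (by linarith)]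
    calc l ^ 2 * V ≤ l ^ 2 * (q * v * (1 + 1.035 * α)) := by gcongr
      _ = q * (l ^ 2 * v) * (1 + 1.035 * α) := by ring
      _ ≤ q * (l ^ 2 * v) * ((1 + 1.037 * α) * (1 - l ^ 2 * V)) := by
        gcongr
        nlinarith
      _ = _ := by ring
  have e1 : x ^ 2 / (2 * v) = l ^ 2 * v / 2 := by rw [hxl]; field_simp
  rw [e1]
  -- The relative losses are `1.143α` in the linear term and `1.037α` in the logarithm. Measured
  -- against the net main term `q l²v/2` they add up to `2 · 1.143α + 1.037α = 3.323α`, just below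
  -- `3.33α`.
  have h5 : l * (q * x - α ^ 2 * s ^ 2 / 4) ≤ l * (capAt s α - α * capacity s) := by gcongr
  have h6 : l * (α ^ 2 * s ^ 2 / 4) ≤ l * (1.143 * (α * (q * x))) := by gcongr
  have h7 : l * (q * x) = q * (l ^ 2 * v) := by rw [hxl]; ring
  have h8 : l * (1.143 * (α * (q * x))) = 1.143 * α * (q * (l ^ 2 * v)) := by rw [hxl]; ring
  have h9 : 0 ≤ α * (q * (l ^ 2 * v)) := by positivity
  nlinarith

lemma mul_exp_neg_le {B n e h : ℝ} (hB : B ≤ Real.log 2 + n * (e - h)) :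
    Real.exp B * Real.exp (-(n * e)) ≤ 2 * Real.exp (-(n * h)) := by
  rw [← Real.exp_add, ← Real.exp_log (show (0 : ℝ) < 2 by norm_num), ← Real.exp_add]
  apply Real.exp_le_exp.2
  linarith

lemma mul_exp_neg_le' {B n e h : ℝ} (hB : B ≤ n * (e - h)) :
    Real.exp B * Real.exp (-(n * e)) ≤ 2 * Real.exp (-(n * h)) :=
  mul_exp_neg_le (hB.trans (by linarith [Real.log_two_gt_d9]))

/-- Bounds on the tilt when it is too small for the refined error event. -/
lemma small_tilt_bounds {s α x l : ℝ} (hs : 0 < s) (hα0 : 0 < α) (hα1 : α < 1) (hl0 : 0 ≤ l)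
    (hge : s / (4 * (1 + s)) * (α * (1 - α) * s / (1 + α * s)) ≤ x)
    (hx : x * (1 - l ^ 2 * (α * (1 - α) * s / (1 + α * s))) = l * (α * (1 - α) * s / (1 + α * s)))
    (hlt : l < 2 * (s / (4 * (1 + s) ^ 2))) :
    l ≤ 1 / 8 ∧ l ≤ s / 2 ∧ s / (4 * (1 + s) ^ 2) ≤ l ∧
      l * (α * (1 - α) * s / (1 + α * s)) ≤ x ∧
      (1 / 10 ≤ s → s / (4 * (1 + s) ^ 2) ≤ 0.92 * l) := by
  set v := α * (1 - α) * s / (1 + α * s) with hv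
  have hp : 0 < 1 + α * s := by positivity
  have hv0 : 0 < v := by
    have : 0 < 1 - α := by linarith
    positivity
  have hvs : v ≤ s := by
    rw [hv, div_le_iff₀ hp]
    nlinarith [mul_pos hα0 hs, mul_pos hs (mul_pos hα0 hs), mul_pos (mul_pos hα0 hs) (sub_pos.2 hα1)]
  have hv1 : v ≤ 1 := by
    rw [hv, div_le_one hp]
    nlinarith [mul_pos hα0 hs, mul_pos hα0 (mul_pos hα0 hs)]
  set w := s / (4 * (1 + s) ^ 2) with hw
  have hw1 : w ≤ 1 / 16 := by
    rw [hw, div_le_iff₀ (by positivity)]; nlinarith [sq_nonneg (1 - s)]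
  have hws : w ≤ s / 4 := by
    rw [hw]; apply div_le_div_of_nonneg_left hs.le (by norm_num); nlinarith
  have hw0 : 0 < w := by positivity
  have hρ : s / (4 * (1 + s)) = (1 + s) * w := by rw [hw]; field_simp
  rw [hρ] at hge
  have hl8 : l ≤ 1 / 8 := by linarith
  have hl2 : l ^ 2 ≤ 1 / 64 := by nlinarith
  have hlv : l ^ 2 * v ≤ 1 / 64 * v := by gcongr
  -- Stationarity reads `l = (x/v)(1 - l²v)`, and `x/v ≥ (1+s)w` by the concavity gap.
  have hl : (1 + s) * w * (1 - v / 64) ≤ l := by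
    have h1 : (1 + s) * w * v * (1 - v / 64) ≤ x * (1 - l ^ 2 * v) := by
      apply mul_le_mul hge (by linarith) (by linarith)
      exact le_trans (by positivity) hge
    rw [hx] at h1
    have : (1 + s) * w * (1 - v / 64) * v ≤ l * v := by linarith
    exact le_of_mul_le_mul_right this hv0
  -- A tilt that is below `2w` but at least `(63/64)(1+s)w` forces `s` to be at most about 1.
  have hs2 : s < 1.04 := by
    have : (1 + s) * (63 / 64) * w < 2 * w := by
      have : (1 + s) * w * (63 / 64) ≤ (1 + s) * w * (1 - v / 64) := by
        gcongr; linarith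
      linarith
    have := lt_of_mul_lt_mul_right this hw0.le
    linarith
  have h64 : (1 + s) * (1 - s / 64) * w ≤ l := by
    refine le_trans ?_ hl
    have : (1 + s) * w * (1 - s / 64) ≤ (1 + s) * w * (1 - v / 64) := by gcongr
    linarith
  refine ⟨hl8, by linarith, ?_, ?_, fun hs1 => ?_⟩
  · have : 1 ≤ (1 + s) * (1 - s / 64) := by nlinarith
    nlinarith
  · rw [← hx]
    have h0 : 0 ≤ x := le_trans (by positivity) hge
    have : 0 ≤ x * (l ^ 2 * v) := by positivity
    linarith
  · have : 1 ≤ 0.92 * ((1 + s) * (1 - s / 64)) := by nlinarith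
    nlinarith

/-! ### Choosing the bound and the tilt for each number of wrong sections. -/

-- The left alternative feeds the unrefined bound, the right one the refined bound. The refined
-- bound at the maximizer `t` of `D1` works if `t ≥ 2w` or `Δ ≤ 4sαt`. Otherwise the unrefined bound
-- is used, with `t` itself, with `t(1+6α)`, or, if both `s` and `α` are small, with the tilt of a
-- single wrong section. The last case needs `hD` at `j = 1`, hence the quantifier over `j`.
set_option maxHeartbeats 1000000 in
theorem exists_exponent_bound {L l : ℕ} {n s Δ h : ℝ} (hL : 2 ≤ L) (hl1 : 1 ≤ l) (hlL : l ≤ L)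
    (hs : 0 < s) (hn : 0 < n) (hΔ : 0 < Δ)
    (hD : ∀ j : ℕ, 1 ≤ j → j ≤ L - 1 → Real.log (L.choose j) ≤
      n * D1 (capAt s ((j : ℝ) / L) - (j : ℝ) / L * capacity s)
          ((j : ℝ) / L * (1 - (j : ℝ) / L) * s / (1 + (j : ℝ) / L * s)))
    {α x : ℝ} (hα : α = (l : ℝ) / L) (hx : x = capAt s α - α * capacity s)
    (h1 : h ≤ α * Δ * wFun s) (h2 : h ≤ 1 / 4 * gFun (Δ / (2 * Real.sqrt s))) :
    (∃ t : ℝ, 0 ≤ t ∧ t ≤ 1 ∧ (L.choose l : ℝ) *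
        Real.exp (-(n * (t * (x + α * Δ) + 1 / 2 * Real.log (1 - t ^ 2 * (α * s / (1 + α * s))))))
          ≤ 2 * Real.exp (-(n * h))) ∨
    ∃ t m τ : ℝ, 0 ≤ t ∧ t ≤ 1 ∧ 0 ≤ m ∧ m ^ 2 * (α ^ 2 * s / (1 + α ^ 2 * s)) < 1 ∧
      (L.choose l : ℝ) * Real.exp (-(n * (t * (x + α * Δ - τ) +
          1 / 2 * Real.log (1 - t ^ 2 * (α * (1 - α) * s / (1 + α * s)))))) +
        Real.exp (-(n * (m * τ + 1 / 2 * Real.log (1 - m ^ 2 * (α ^ 2 * s / (1 + α ^ 2 * s))))))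
      ≤ 2 * Real.exp (-(n * h)) := by
  have hL0 : (0 : ℝ) < L := by exact_mod_cast (by omega : 0 < L)
  have hl0 : (0 : ℝ) < l := by exact_mod_cast hl1
  have hα0 : 0 < α := by rw [hα]; positivity
  have hα1 : α ≤ 1 := by rw [hα, div_le_one hL0]; exact_mod_cast hlL
  have hC : (0 : ℝ) < L.choose l := by exact_mod_cast Nat.choose_pos hlL
  rw [← Real.exp_log hC]
  set B := Real.log (L.choose l) with hB
  have hp : 0 < 1 + α * s := by positivity
  set w := s / (4 * (1 + s) ^ 2) with hw
  have h3 : h ≤ α * Δ * w := h1.trans (by gcongr; exact wFun_le hs)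
  have hw1 : 2 * w ≤ 1 := by
    rw [hw, ← mul_div_assoc, div_le_one (by positivity)]; nlinarith [sq_nonneg (1 - s)]
  have hv0 : 0 ≤ α * (1 - α) * s / (1 + α * s) := by
    have : 0 ≤ 1 - α := by linarith
    positivity
  have hge := capAt_sub_ge hs hα0.le hα1
  rw [← hx] at hge
  -- At `α = 1`, which `hD` does not cover, there is one pattern, `x = 0` and the residual variance
  -- vanishes, so tilt 1 works.
  rcases eq_or_lt_of_le hα1 with ha | ha
  · right
    have hlL' : l = L := by
      have : (l : ℝ) = L := by rw [ha, eq_div_iff hL0.ne'] at hα; linarith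
      exact_mod_cast this
    have hx0 : x = 0 := by rw [hx, ha]; unfold capacity; ring
    obtain ⟨m, τ, hm0, hm1, hm⟩ := exists_truncation (B := B) (x := x) (l := 1)
      (v := α * (1 - α) * s / (1 + α * s)) hs hα0 hΔ hn.le
      (by rw [hB, hlL', hx0, ha]; simp) (by nlinarith [mul_pos hα0 hΔ]) h2
    exact ⟨1, m, τ, zero_le_one, le_rfl, hm0, hm1, hm⟩
  have hlt : l < L := by
    have : (l : ℝ) < L := by rwa [hα, div_lt_one hL0] at ha
    exact_mod_cast this
  have hBD : B ≤ n * D1 x (α * (1 - α) * s / (1 + α * s)) := by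
    have := hD l hl1 (by omega)
    rwa [← hα, ← hx] at this
  have hv1 : α * (1 - α) * s / (1 + α * s) < 1 := by
    rw [div_lt_one hp]; nlinarith [mul_pos hα0 hs, mul_pos hα0 (mul_pos hα0 hs)]
  obtain ⟨t, ht0, ht1, htD, ht⟩ := exists_D1_le hv0 hv1 (le_trans (by positivity) hge)
  have hBt := hBD.trans (mul_le_mul_of_nonneg_left htD hn.le)
  have trunc : h ≤ t * α * Δ / 2 → _ := fun hh =>
    exists_truncation (B := B) (x := x) (l := t) (v := α * (1 - α) * s / (1 + α * s))
      hs hα0 hΔ hn.le hBt hh h2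
  rcases le_or_gt (2 * w) t with hA | hA
  · right
    obtain ⟨m, τ, hm0, hm1, hm⟩ := trunc (by nlinarith [mul_pos hα0 hΔ])
    exact ⟨t, m, τ, ht0, ht1, hm0, hm1, hm⟩
  -- `g(y) ≤ 2y²` makes this part of `h` quadratic in `Δ`, hence harmless for small `Δ`.
  have hg : h ≤ Δ ^ 2 / (8 * s) := by
    refine h2.trans ?_
    have := gFun_le (Δ / (2 * Real.sqrt s))
    rw [div_pow, mul_pow, Real.sq_sqrt hs.le] at this
    have e : Δ ^ 2 / (8 * s) = 1 / 4 * (2 * (Δ ^ 2 / (2 ^ 2 * s))) := by field_simp; ring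
    rw [e]; gcongr
  rcases le_or_gt Δ (4 * s * α * t) with hB1 | hB1
  · right
    have : Δ ^ 2 / (8 * s) ≤ t * α * Δ / 2 := by
      rw [div_le_iff₀ (by positivity)]; nlinarith
    obtain ⟨m, τ, hm0, hm1, hm⟩ := trunc (by linarith)
    exact ⟨t, m, τ, ht0, ht1, hm0, hm1, hm⟩
  left
  obtain ⟨ht8, hts, hwt, hxt, hw92⟩ := small_tilt_bounds hs hα0 ha ht0 hge
    (ht.resolve_left (by intro h; linarith)) hA
  have hloss := untruncated_loss hs hα0 ht0 ht8
  rcases le_or_gt Δ (7 * s * α * t) with hB2 | hB2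
  · refine ⟨t, ht0, ht1, mul_exp_neg_le' (hBt.trans (mul_le_mul_of_nonneg_left ?_ hn.le))⟩
    -- For `Δ = c·sαt` this is `c²/8 ≤ c - 32/63`, valid for `4 ≤ c ≤ 7`.
    have : Δ ^ 2 / (8 * s) ≤ t * α * Δ - 32 / 63 * (t ^ 2 * α ^ 2 * s) := by
      rw [div_le_iff₀ (by positivity)]
      have h4 := mul_nonneg (sub_nonneg.2 hB1.le) (sub_nonneg.2 hB2)
      have h5 := mul_nonneg (sub_nonneg.2 hB2) (by positivity : 0 ≤ s * α * t)
      have h6 := sq_nonneg (s * α * t)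
      linarith
    linarith
  -- The loss `(32/63) t²α²s` becomes at most `(32/441) tαΔ`, below the `0.08 tαΔ` left over by `w ≤
  -- 0.92 t`.
  have hsmall : 7 * (t ^ 2 * α ^ 2 * s) ≤ t * α * Δ := by
    have := mul_le_mul_of_nonneg_left hB2.le (mul_nonneg ht0 hα0.le)
    linarith
  rcases le_or_gt (1 / 10) s with hs1 | hs1
  · refine ⟨t, ht0, ht1, mul_exp_neg_le' (hBt.trans (mul_le_mul_of_nonneg_left ?_ hn.le))⟩
    have h5 : α * Δ * w ≤ α * Δ * (0.92 * t) := by gcongr; exact hw92 hs1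
    have : 0 ≤ t * α * Δ := by positivity
    linarith
  rcases le_or_gt (1 / 30) α with ha30 | ha30
  · have := larger_tilt (x := x) hs hs1 ha30 hα1 ht0 hts hwt hB2.le hxt
    refine ⟨t * (1 + 6 * α), by positivity, ?_,
      mul_exp_neg_le' (hBt.trans (mul_le_mul_of_nonneg_left ?_ hn.le))⟩
    · nlinarith
    · linarith
  have h30 : 30 * l ≤ L := by
    have : 30 * (l : ℝ) ≤ L := by
      rw [hα, div_lt_div_iff₀ hL0 (by norm_num)] at ha30; linarith
    exact_mod_cast this
  -- Now `s < 1/10` and `α < 1/30`. The tilt is the one for a single wrong section: `hD 1` bounds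
  -- `log L`, and the margin of `log (L choose l)` below `l log L` pays for the nonlinearity in `α`.
  set a : ℝ := ((1 : ℕ) : ℝ) / L with ha_def
  have hla : α = l * a := by rw [hα, ha_def]; push_cast; ring
  have ha0 : 0 < a := by rw [ha_def]; positivity
  have hl1' : (1 : ℝ) ≤ l := by exact_mod_cast hl1
  have haα : a ≤ α := by rw [hla]; nlinarith
  obtain ⟨hr0, hr1, hr⟩ := small_fraction_exponent hs hs1 ha0 hl1' (by linarith) rfl
  rw [← hla, ← hx] at hr
  set r := (capAt s a - a * capacity s) / (a * (1 - a) * s / (1 + a * s)) with hr_def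
  have hr0' : 0 ≤ r := le_trans (by positivity) hr0
  have hwr : w ≤ r := by
    refine le_trans ?_ hr0
    rw [hw]; apply div_le_div_of_nonneg_left hs.le (by positivity); nlinarith
  refine ⟨r, hr0', hr1, mul_exp_neg_le ?_⟩
  have hva : 0 < a * (1 - a) * s / (1 + a * s) := by
    have : 0 < 1 - a := by linarith
    positivity
  have hva1 : a * (1 - a) * s / (1 + a * s) < 1 := by
    rw [div_lt_one (by positivity)]; nlinarith [mul_pos ha0 hs, mul_pos ha0 (mul_pos ha0 hs)]
  have hlogL : Real.log L ≤ n * ((capAt s a - a * capacity s) ^ 2 /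
      (2 * (a * (1 - a) * s / (1 + a * s)))) := by
    have := hD 1 le_rfl (by omega)
    rw [Nat.choose_one_right] at this
    exact this.trans (mul_le_mul_of_nonneg_left (D1_le_sq_div hva hva1) hn.le)
  have hBs := log_choose_le_of_small hl1 h30
  rw [← hα] at hBs
  have h6 : (l : ℝ) * Real.log L * (1 - 3.33 * α) ≤ l * (n * ((capAt s a - a * capacity s) ^ 2 /
      (2 * (a * (1 - a) * s / (1 + a * s))))) * (1 - 3.33 * α) := by
    gcongr
    linarith
  have h7 := mul_le_mul_of_nonneg_left hr hn.le
  have h8 : α * Δ * w ≤ r * (α * Δ) := by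
    rw [mul_comm r]; gcongr
  have h9 := mul_le_mul_of_nonneg_left (h3.trans h8) hn.le
  linarith

/-! ### Gaussian exponential moments. -/

/-- Completing the square turns the integrand into a constant times the density of `N(bu, u)` with
`u = v/(1+av)`. -/
lemma lintegral_gaussianReal_exp_quadratic (v : ℝ≥0) (a b : ℝ) (h : 0 < 1 + a * v) :
    ∫⁻ x, ENNReal.ofReal (Real.exp (-(a / 2) * x ^ 2 + b * x)) ∂(gaussianReal 0 v) =
      ENNReal.ofReal ((Real.sqrt (1 + a * v))⁻¹ * Real.exp (b ^ 2 * v / (2 * (1 + a * v)))) := by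
  rcases eq_or_ne v 0 with rfl | hv
  · simp
  have hv0 : (0 : ℝ) < v := by exact_mod_cast pos_iff_ne_zero.2 hv
  obtain ⟨u, hu⟩ : ∃ u : ℝ≥0, (u : ℝ) = v / (1 + a * v) := ⟨⟨v / (1 + a * v), by positivity⟩, rfl⟩
  have hu0 : u ≠ 0 := by
    have : (0 : ℝ) < u := by rw [hu]; positivity
    exact_mod_cast this.ne'
  rw [gaussianReal_of_var_ne_zero 0 hv, lintegral_withDensity_eq_lintegral_mul _
    (measurable_gaussianPDF 0 v) (by fun_prop)]
  have key : ∀ x, (gaussianPDF 0 v * fun x => ENNReal.ofReal (Real.exp (-(a / 2) * x ^ 2 + b * x))) x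
      = ENNReal.ofReal ((Real.sqrt (1 + a * v))⁻¹ * Real.exp (b ^ 2 * v / (2 * (1 + a * v)))) *
        gaussianPDF (b * u) u x := by
    intro x
    rw [Pi.mul_apply, gaussianPDF, gaussianPDF, ← ENNReal.ofReal_mul (gaussianPDFReal_nonneg _ _ _),
      ← ENNReal.ofReal_mul (by positivity)]
    congr 1
    rw [gaussianPDFReal, gaussianPDFReal, mul_assoc, ← Real.exp_add]
    have e1 : (Real.sqrt (2 * Real.pi * v))⁻¹
        = (Real.sqrt (1 + a * v))⁻¹ * (Real.sqrt (2 * Real.pi * u))⁻¹ := by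
      rw [← mul_inv, ← Real.sqrt_mul h.le]
      congr 2
      rw [hu, mul_comm (1 + a * (v : ℝ)), mul_assoc _ (_ / _), div_mul_cancel₀ _ h.ne']
    have e2 : -(x - 0) ^ 2 / (2 * (v : ℝ)) + (-(a / 2) * x ^ 2 + b * x)
        = b ^ 2 * v / (2 * (1 + a * v)) + -(x - b * u) ^ 2 / (2 * u) := by
      obtain ⟨d, hd⟩ : ∃ d : ℝ, d = 1 + a * v := ⟨_, rfl⟩
      have ha : a = (d - 1) / v := by rw [hd]; field_simp; ring
      rw [hu, ← hd]
      rw [← hd] at h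
      rw [ha]
      field_simp
      ring
    rw [e1, e2, Real.exp_add]
    ring
  rw [lintegral_congr key, lintegral_const_mul _ (measurable_gaussianPDF _ _),
    lintegral_gaussianPDF_eq_one _ hu0, mul_one]

lemma lintegral_gaussianReal_exp_sub_sq (v : ℝ≥0) {c : ℝ} (hc : 0 < c) (u : ℝ) :
    ∫⁻ x, ENNReal.ofReal (Real.exp (-((u - x) ^ 2 / (2 * c)))) ∂(gaussianReal 0 v) =
      ENNReal.ofReal ((Real.sqrt (1 + v / c))⁻¹ * Real.exp (-(u ^ 2 / (2 * (c + v))))) := by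
  have h : 0 < 1 + 1 / c * (v : ℝ) := by positivity
  have e : ∀ x, ENNReal.ofReal (Real.exp (-((u - x) ^ 2 / (2 * c)))) =
      ENNReal.ofReal (Real.exp (-(u ^ 2 / (2 * c)))) *
        ENNReal.ofReal (Real.exp (-((1 / c) / 2) * x ^ 2 + u / c * x)) := by
    intro x
    rw [← ENNReal.ofReal_mul (by positivity), ← Real.exp_add]
    congr 2; field_simp; ring
  rw [lintegral_congr e, lintegral_const_mul _ (by fun_prop),
    lintegral_gaussianReal_exp_quadratic v _ _ h, ← ENNReal.ofReal_mul (by positivity),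
    mul_left_comm, ← Real.exp_add]
  congr 3
  · congr 1; ring
  · field_simp; ring

/-- The exponential moment of half the difference of the squares of two correlated standard normal
variables. -/
lemma lintegral_exp_sq_sub_sq (A B : ℝ≥0) (hA : 0 < A) {l : ℝ} (hl : 0 ≤ l)
    (hl1 : l ^ 2 * ((B : ℝ) / (A + B)) < 1) :
    ∫⁻ z, ∫⁻ y, ENNReal.ofReal (Real.exp (-(l * ((z + y) ^ 2 / (2 * (A + B)) - z ^ 2 / (2 * A)))))
        ∂(gaussianReal 0 B) ∂(gaussianReal 0 A) =
      ENNReal.ofReal ((Real.sqrt (1 - l ^ 2 * ((B : ℝ) / (A + B))))⁻¹) := by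
  have hA0 : (0 : ℝ) < A := by exact_mod_cast hA
  have hS : (0 : ℝ) < A + B := by positivity
  have h1 : 0 < 1 + l / (A + B) * (B : ℝ) := by positivity
  have hSl : 0 < A + B + l * (B : ℝ) := by positivity
  have in1 : ∀ z, ∫⁻ y, ENNReal.ofReal (Real.exp (-(l * ((z + y) ^ 2 / (2 * (A + B))
        - z ^ 2 / (2 * A))))) ∂(gaussianReal 0 B) =
      ENNReal.ofReal ((Real.sqrt (1 + l / (A + B) * (B : ℝ)))⁻¹) *
        ENNReal.ofReal (Real.exp (-((l / (A + B) - l / A -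
          l ^ 2 * B / ((A + B) * (A + B + l * B))) / 2) * z ^ 2 + 0 * z)) := by
    intro z
    have e : ∀ y : ℝ, ENNReal.ofReal (Real.exp (-(l * ((z + y) ^ 2 / (2 * (A + B))
        - z ^ 2 / (2 * A))))) = ENNReal.ofReal (Real.exp (-(l * (z ^ 2 / (2 * (A + B))
        - z ^ 2 / (2 * A))))) * ENNReal.ofReal (Real.exp (-((l / (A + B)) / 2) * y ^ 2 +
          (-(l * z / (A + B))) * y)) := by
      intro y
      rw [← ENNReal.ofReal_mul (by positivity), ← Real.exp_add]
      congr 2; field_simp; ring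
    rw [lintegral_congr e, lintegral_const_mul _ (by fun_prop),
      lintegral_gaussianReal_exp_quadratic B _ _ h1, ← ENNReal.ofReal_mul (by positivity),
      mul_left_comm, ← Real.exp_add, ← ENNReal.ofReal_mul (by positivity)]
    congr 3
    field_simp
    ring
  have e2 : (1 + l / (A + B) * (B : ℝ)) * (1 + (l / (A + B) - l / A -
          l ^ 2 * B / ((A + B) * (A + B + l * B))) * A) = 1 - l ^ 2 * ((B : ℝ) / (A + B)) := by
    field_simp; ring
  -- Positive because its product with the positive first factor is `1 - l²B/(A+B)`.
  have h2 : 0 < 1 + (l / (A + B) - l / A - l ^ 2 * B / ((A + B) * (A + B + l * B))) * (A : ℝ) := by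
    refine (mul_pos_iff_of_pos_left h1).1 ?_
    rw [e2]; linarith
  rw [lintegral_congr in1, lintegral_const_mul _ (by fun_prop),
    lintegral_gaussianReal_exp_quadratic A _ _ h2, ← ENNReal.ofReal_mul (by positivity),
    ← mul_assoc, ← mul_inv, ← Real.sqrt_mul h1.le, e2]
  simp

/-! ### Linear forms of i.i.d. Gaussian vectors. -/

section LinearForms

variable {ι : Type*} [Fintype ι]

lemma hasGaussianLaw_pi_id (v : ℝ≥0) :
    HasGaussianLaw (fun a : ι → ℝ => a) (Measure.pi fun _ : ι => gaussianReal 0 v) := by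
  have h : iIndepFun (fun (i : ι) (a : ι → ℝ) => a i) (Measure.pi fun _ : ι => gaussianReal 0 v) :=
    iIndepFun_pi (X := fun _ x => x) (fun _ => aemeasurable_id)
  refine h.hasGaussianLaw fun i => ?_
  have : HasLaw (fun a : ι → ℝ => a i) (gaussianReal 0 v)
      (Measure.pi fun _ : ι => gaussianReal 0 v) :=
    ⟨(measurable_pi_apply i).aemeasurable, (measurePreserving_eval _ i).map_eq⟩
  exact this.hasGaussianLaw

lemma covariance_pi_eval (v : ℝ≥0) (i j : ι) [DecidableEq ι] :
    cov[fun a : ι → ℝ => a i, fun a => a j; Measure.pi fun _ : ι => gaussianReal 0 v] =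
      if i = j then (v : ℝ) else 0 := by
  have hm : ∀ i, MemLp (fun a : ι → ℝ => a i) 2 (Measure.pi fun _ : ι => gaussianReal 0 v) :=
    fun i => ((hasGaussianLaw_pi_id v).eval i).memLp_two
  split_ifs with h
  · subst h
    rw [covariance_self (measurable_pi_apply i).aemeasurable]
    have := variance_map (X := fun x : ℝ => x) (Y := fun a : ι → ℝ => a i)
      (μ := Measure.pi fun _ : ι => gaussianReal 0 v) (by fun_prop) (measurable_pi_apply i).aemeasurable
    rw [(measurePreserving_eval (fun _ : ι => gaussianReal 0 v) i).map_eq,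
      variance_fun_id_gaussianReal] at this
    exact this.symm
  · have h1 : iIndepFun (fun (i : ι) (a : ι → ℝ) => a i)
        (Measure.pi fun _ : ι => gaussianReal 0 v) :=
      iIndepFun_pi (X := fun _ x => x) (fun _ => aemeasurable_id)
    exact (h1.indepFun h).covariance_eq_zero (hm i) (hm j)

lemma covariance_linear_pi (v : ℝ≥0) (b c : ι → ℝ) :
    cov[fun a : ι → ℝ => ∑ i, b i * a i, fun a => ∑ i, c i * a i;
      Measure.pi fun _ : ι => gaussianReal 0 v] = v * ∑ i, b i * c i := by
  classical
  have hm : ∀ (b : ι → ℝ) (i : ι),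
      MemLp (fun a : ι → ℝ => b i * a i) 2 (Measure.pi fun _ : ι => gaussianReal 0 v) :=
    fun b i => (((hasGaussianLaw_pi_id v).eval i).memLp_two).const_mul _
  rw [covariance_fun_sum_fun_sum (hm b) (hm c)]
  simp_rw [covariance_const_mul_left, covariance_const_mul_right, covariance_pi_eval]
  simp only [mul_ite, mul_zero, Finset.sum_ite_eq, Finset.mem_univ, if_true]
  rw [Finset.mul_sum]
  exact Finset.sum_congr rfl fun i _ => by ring

lemma map_linear_pi (v : ℝ≥0) (b : ι → ℝ) (B : ℝ≥0) (hB : (B : ℝ) = v * ∑ i, b i ^ 2) :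
    (Measure.pi fun _ : ι => gaussianReal 0 v).map (fun a => ∑ i, b i * a i) =
      gaussianReal 0 B := by
  have hg : HasGaussianLaw (fun a : ι → ℝ => ∑ i, b i * a i)
      (Measure.pi fun _ : ι => gaussianReal 0 v) := by
    have := (hasGaussianLaw_pi_id (ι := ι) v).map_fun
      (∑ i, b i • ContinuousLinearMap.proj (R := ℝ) (φ := fun _ : ι => ℝ) i)
    simpa [sum_apply] using this
  rw [hg.map_eq_gaussianReal]
  congr 1
  · rw [integral_finsetSum]
    · apply Finset.sum_eq_zero fun i _ => ?_
      rw [integral_const_mul]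
      have := integral_map (μ := Measure.pi fun _ : ι => gaussianReal 0 v)
        (φ := fun a : ι → ℝ => a i) (measurable_pi_apply i).aemeasurable (f := fun x : ℝ => x) (by fun_prop)
      rw [(measurePreserving_eval (fun _ : ι => gaussianReal 0 v) i).map_eq,
        integral_id_gaussianReal] at this
      rw [← this, mul_zero]
    · intro i _
      exact (((hasGaussianLaw_pi_id v).eval i).integrable).const_mul _
  · rw [← covariance_self hg.aemeasurable, covariance_linear_pi]
    apply NNReal.eq
    have h0 : 0 ≤ (v : ℝ) * ∑ i, b i * b i :=
      mul_nonneg v.2 (Finset.sum_nonneg fun i _ => mul_self_nonneg _)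
    rw [Real.coe_toNNReal _ h0, hB]
    simp [sq]

/-- The two forms are jointly Gaussian and uncorrelated, hence independent. -/
lemma map_linear_pair_pi (v : ℝ≥0) (b c : ι → ℝ) (B C : ℝ≥0) (hB : (B : ℝ) = v * ∑ i, b i ^ 2)
    (hC : (C : ℝ) = v * ∑ i, c i ^ 2) (h : ∑ i, b i * c i = 0) :
    (Measure.pi fun _ : ι => gaussianReal 0 v).map (fun a => (∑ i, b i * a i, ∑ i, c i * a i)) =
      (gaussianReal 0 B).prod (gaussianReal 0 C) := by
  have hg : HasGaussianLaw (fun a : ι → ℝ => (∑ i, b i * a i, ∑ i, c i * a i))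
      (Measure.pi fun _ : ι => gaussianReal 0 v) := by
    have := (hasGaussianLaw_pi_id (ι := ι) v).map_fun
      ((∑ i, b i • ContinuousLinearMap.proj (R := ℝ) (φ := fun _ : ι => ℝ) i).prod
       (∑ i, c i • ContinuousLinearMap.proj (R := ℝ) (φ := fun _ : ι => ℝ) i))
    simpa [sum_apply] using this
  have hi := hg.indepFun_of_covariance_eq_zero (by rw [covariance_linear_pi, h, mul_zero])
  rw [(indepFun_iff_map_prod_eq_prod_map_map
      (Measurable.aemeasurable (by fun_prop)) (Measurable.aemeasurable (by fun_prop))).1 hi,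
    map_linear_pi v b B hB, map_linear_pi v c C hC]

/-- Joint law of a noisy linear form and an uncorrelated linear form of a Gaussian vector. -/
lemma lintegral_noisy_linear_pair (v N : ℝ≥0) (b c : ι → ℝ) (B C : ℝ≥0)
    (hB : (B : ℝ) = v * ∑ i, b i ^ 2) (hC : (C : ℝ) = v * ∑ i, c i ^ 2)
    (h : ∑ i, b i * c i = 0) {F : ℝ → ℝ → ℝ≥0∞} (hF : Measurable (Function.uncurry F)) :
    ∫⁻ p, F (p.2 + ∑ i, b i * p.1 i) (∑ i, c i * p.1 i)
        ∂((Measure.pi fun _ : ι => gaussianReal 0 v).prod (gaussianReal 0 N)) =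
      ∫⁻ z, ∫⁻ y, F z y ∂(gaussianReal 0 C) ∂(gaussianReal 0 (N + B)) := by
  have hF' : Measurable fun q : ℝ × ℝ => F q.1 q.2 := hF
  have hG : Measurable fun z => ∫⁻ y, F z y ∂(gaussianReal 0 C) := hF'.lintegral_prod_right'
  rw [lintegral_prod_symm' _ (by fun_prop)]
  have e : ∀ w : ℝ, ∫⁻ a, F (w + ∑ i, b i * a i) (∑ i, c i * a i)
      ∂(Measure.pi fun _ : ι => gaussianReal 0 v) =
      ∫⁻ u, ∫⁻ y, F (w + u) y ∂(gaussianReal 0 C) ∂(gaussianReal 0 B) := by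
    intro w
    rw [← lintegral_prod (fun q : ℝ × ℝ => F (w + q.1) q.2) (by fun_prop),
      ← map_linear_pair_pi v b c B C hB hC h, lintegral_map (by fun_prop) (by fun_prop)]
  rw [lintegral_congr e, ← add_zero (0 : ℝ), ← gaussianReal_conv_gaussianReal, add_zero,
    Measure.lintegral_conv hG]

end LinearForms

/-! ### Integrals over product measures. -/

section Product

variable {ι X : Type*} [Fintype ι] [MeasurableSpace X]

lemma measurePreserving_pi_zip (μ : Measure X) [IsProbabilityMeasure μ] {f : ι → X × X → X}
    (hf : ∀ i, MeasurePreserving (f i) (μ.prod μ) μ) :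
    MeasurePreserving (fun q : (ι → X) × (ι → X) => fun i => f i (q.1 i, q.2 i))
      ((Measure.pi fun _ => μ).prod (Measure.pi fun _ => μ)) (Measure.pi fun _ => μ) :=
  (measurePreserving_pi (fun _ => μ.prod μ) (fun _ => μ) hf).comp
    (measurePreserving_arrowProdEquivProdArrow X X ι (fun _ => μ) (fun _ => μ)).symm

lemma lintegral_pi_prod (μ : Measure X) [IsProbabilityMeasure μ] {f : X → ℝ≥0∞}
    (hf : Measurable f) :
    ∫⁻ x, ∏ i : ι, f (x i) ∂(Measure.pi fun _ => μ) = (∫⁻ x, f x ∂μ) ^ Fintype.card ι := by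
  rw [lintegral_prod_eq_prod_lintegral_of_indepFun Finset.univ (fun i (x : ι → X) => f (x i))
    (iIndepFun_pi (X := fun _ => f) fun _ => hf.aemeasurable) (fun i => hf.comp (measurable_pi_apply i))]
  have : ∀ i : ι, ∫⁻ x : ι → X, f (x i) ∂(Measure.pi fun _ => μ) = ∫⁻ x, f x ∂μ := fun i =>
    (measurePreserving_eval (fun _ => μ) i).lintegral_comp hf
  simp [this]

lemma lintegral_pi_prod_pi_prod {Y : Type*} [MeasurableSpace Y] (μ : Measure X) (ν : Measure Y)
    [IsProbabilityMeasure μ] [IsProbabilityMeasure ν] {f : X × Y → ℝ≥0∞} (hf : Measurable f) :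
    ∫⁻ ω, ∏ i : ι, f (ω.1 i, ω.2 i) ∂((Measure.pi fun _ => μ).prod (Measure.pi fun _ => ν)) =
      (∫⁻ x, f x ∂(μ.prod ν)) ^ Fintype.card ι := by
  rw [← lintegral_pi_prod (μ.prod ν) hf,
    ← (measurePreserving_arrowProdEquivProdArrow X Y ι (fun _ => μ) (fun _ => ν)).lintegral_comp
      (by fun_prop)]
  rfl

/-- Jensen for a concave power, as Hölder against the constant 1. This confines the random coding
tilts to `[0,1]`. -/
lemma lintegral_rpow_le (μ : Measure X) [IsProbabilityMeasure μ] {f : X → ℝ≥0∞}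
    (hf : Measurable f) {l : ℝ} (h0 : 0 ≤ l) (h1 : l ≤ 1) :
    ∫⁻ x, f x ^ l ∂μ ≤ (∫⁻ x, f x ∂μ) ^ l := by
  simpa using ENNReal.lintegral_mul_norm_pow_le (μ := μ) hf.aemeasurable
    (aemeasurable_const (b := (1 : ℝ≥0∞))) h0 (sub_nonneg.2 h1) (by ring)

end Product

/-! ### Random coding: averaging over the columns not used by the sent message. -/

/-- The law of one row of the design matrix. -/
abbrev rowMeasure (n L M : ℕ) : Measure (Fin L × Fin M → ℝ) :=
  Measure.pi fun _ => gaussianReal 0 ((n : ℝ≥0)⁻¹)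

/-- The coefficients of the part of a message vector supported on the sections in `W`. -/
def partCoef (c : ℝ) {L M : ℕ} (s : Fin L → Fin M) (W : Finset (Fin L)) : Fin L × Fin M → ℝ :=
  fun j => if j.2 = s j.1 ∧ j.1 ∈ W then c else 0

/-- The contribution of the sections in `W` to a codeword symbol. -/
def partSum (c : ℝ) {L M : ℕ} (s : Fin L → Fin M) (W : Finset (Fin L)) (a : Fin L × Fin M → ℝ) :
    ℝ :=
  ∑ j, partCoef c s W j * a j

/-- Replace the entries of a row which are not used by the message `s`. -/
def mixRow {L M : ℕ} (s : Fin L → Fin M) (q : (Fin L × Fin M → ℝ) × (Fin L × Fin M → ℝ)) :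
    Fin L × Fin M → ℝ :=
  fun j => if j.2 = s j.1 then q.1 j else q.2 j

@[fun_prop]
lemma measurable_partSum (c : ℝ) {L M : ℕ} (s : Fin L → Fin M) (W : Finset (Fin L)) :
    Measurable (partSum c s W) := by
  unfold partSum; fun_prop

lemma measurePreserving_mixRow {n L M : ℕ} (s : Fin L → Fin M) :
    MeasurePreserving (mixRow s) ((rowMeasure n L M).prod (rowMeasure n L M))
      (rowMeasure n L M) := by
  refine measurePreserving_pi_zip _
    (f := fun (j : Fin L × Fin M) (q : ℝ × ℝ) => if j.2 = s j.1 then q.1 else q.2) fun j => ?_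
  by_cases h : j.2 = s j.1
  · simp only [h, if_true]; exact measurePreserving_fst
  · simp only [h, if_false]; exact measurePreserving_snd

@[fun_prop]
lemma measurable_mixRow {L M : ℕ} (s : Fin L → Fin M) : Measurable (mixRow s) :=
  (measurePreserving_mixRow (n := 1) s).measurable

/-- Resampling the unused entries keeps the law, so one can average over fresh unused columns with
the used ones fixed, without splitting the product space. -/
lemma measurePreserving_mix {n L M : ℕ} (s : Fin L → Fin M) :
    MeasurePreserving (fun q : Design n L M × Design n L M => fun i => mixRow s (q.1 i, q.2 i))
      ((designMeasure n L M).prod (designMeasure n L M)) (designMeasure n L M) :=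
  measurePreserving_pi_zip _ fun _ => measurePreserving_mixRow s

lemma codeword_eq_partSum {n L M : ℕ} (P : ℝ) (A : Design n L M) (s : Fin L → Fin M) (i : Fin n) :
    codeword P A s i = partSum (Real.sqrt (n * P / L)) s Finset.univ (A i) := by
  simp [codeword, partSum, partCoef, Matrix.mulVec, dotProduct, msgVec, mul_comm]

/-- The sections in which `t` differs from `s`. -/
def diffSet {L M : ℕ} (s t : Fin L → Fin M) : Finset (Fin L) :=
  Finset.univ.filter fun l => t l ≠ s l

/-- Where `s` and `t` agree they use the same entries, which cancel; where they differ, `t` uses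
only resampled entries. -/
lemma partSum_mixRow_sub {L M : ℕ} (c : ℝ) (s t : Fin L → Fin M) (a a' : Fin L × Fin M → ℝ) :
    partSum c s Finset.univ (mixRow s (a, a')) - partSum c t Finset.univ (mixRow s (a, a')) =
      partSum c s (diffSet s t) a - partSum c t (diffSet s t) a' := by
  unfold partSum
  rw [← Finset.sum_sub_distrib, ← Finset.sum_sub_distrib]
  refine Finset.sum_congr rfl fun j _ => ?_
  simp only [partCoef, mixRow, diffSet, Finset.mem_univ, and_true, Finset.mem_filter, true_and]
  by_cases h1 : j.2 = s j.1 <;> by_cases h2 : t j.1 = s j.1 <;>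
    by_cases h3 : j.2 = t j.1 <;> simp_all

lemma sum_partCoef_mul {L M : ℕ} (c : ℝ) (s : Fin L → Fin M) (W V : Finset (Fin L)) (h : W ⊆ V) :
    ∑ j, partCoef c s W j * partCoef c s V j = W.card * c ^ 2 := by
  rw [Fintype.sum_prod_type]
  have : ∀ l : Fin L, ∑ m : Fin M, partCoef c s W (l, m) * partCoef c s V (l, m) =
      if l ∈ W then c ^ 2 else 0 := by
    intro l
    by_cases hl : l ∈ W
    · have hV := h hl
      simp [partCoef, hl, hV, sq]
    · simp [partCoef, hl]
  simp [this]

lemma card_diffSet_eq_le {L M : ℕ} (s : Fin L → Fin M) (W : Finset (Fin L)) :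
    (Finset.univ.filter fun t => diffSet s t = W).card ≤ M ^ W.card := by
  have h : Fintype.card (W → Fin M) = M ^ W.card := by simp
  rw [← h, ← Finset.card_univ]
  refine Finset.card_le_card_of_injOn (fun t l => t l.1) (fun _ _ => Finset.mem_univ _) ?_
  intro t ht t' ht' htt
  simp only [Finset.coe_filter, Finset.mem_univ, true_and, Set.mem_ofPred_eq] at ht ht'
  funext l
  by_cases hl : l ∈ W
  · exact congrFun htt ⟨l, hl⟩
  · have h1 : l ∉ diffSet s t := by rwa [ht]
    have h2 : l ∉ diffSet s t' := by rwa [ht']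
    simp only [diffSet, Finset.mem_filter, Finset.mem_univ, true_and, not_not] at h1 h2
    rw [h1, h2]

instance (n L M : ℕ) : IsProbabilityMeasure (designMeasure n L M) := by
  unfold designMeasure; infer_instance

instance (n : ℕ) (σ : ℝ) : IsProbabilityMeasure (noiseMeasure n σ) := by
  unfold noiseMeasure; infer_instance

/-- The joint law of a row of the design matrix and the corresponding noise symbol. -/
abbrev rowNoise (n L M : ℕ) (σ : ℝ) : Measure ((Fin L × Fin M → ℝ) × ℝ) :=
  (rowMeasure n L M).prod (gaussianReal 0 (Real.toNNReal (σ ^ 2)))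

lemma lintegral_channel_prod {n L M : ℕ} (σ : ℝ) {f : (Fin L × Fin M → ℝ) × ℝ → ℝ≥0∞}
    (hf : Measurable f) :
    ∫⁻ ω, ∏ i, f (ω.1 i, ω.2 i) ∂(channelMeasure n L M σ) = (∫⁻ x, f x ∂(rowNoise n L M σ)) ^ n := by
  have := lintegral_pi_prod_pi_prod (ι := Fin n) (rowMeasure n L M)
    (gaussianReal 0 (Real.toNNReal (σ ^ 2))) hf
  rwa [Fintype.card_fin] at this

lemma measurable_codeword {n L M : ℕ} (P : ℝ) (s : Fin L → Fin M) (i : Fin n) :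
    Measurable fun A : Design n L M => codeword P A s i := by
  simp_rw [codeword_eq_partSum]; fun_prop

lemma one_le_exp_sum_rpow {x : ℝ} (hx : 0 ≤ x) {y : ℝ≥0∞} (hy : ENNReal.ofReal (Real.exp x) ≤ y)
    {l : ℝ} (hl : 0 ≤ l) : 1 ≤ y ^ l := by
  have h1 : 1 ≤ y := le_trans (ENNReal.one_le_ofReal.2 (Real.one_le_exp hx)) hy
  simpa using ENNReal.rpow_le_rpow h1 hl

lemma ofReal_exp_sum {ι : Type*} [Fintype ι] (f : ι → ℝ) :
    ENNReal.ofReal (Real.exp (∑ i, f i)) = ∏ i, ENNReal.ofReal (Real.exp (f i)) := by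
  rw [Real.exp_sum, ENNReal.ofReal_prod_of_nonneg fun _ _ => (Real.exp_pos _).le]

lemma map_partSum {n L M : ℕ} (P : ℝ) (hn : 0 < n) (hP : 0 ≤ P) (hL : 0 < L)
    (s : Fin L → Fin M) (W : Finset (Fin L)) :
    (rowMeasure n L M).map (partSum (Real.sqrt (n * P / L)) s W) =
      gaussianReal 0 (Real.toNNReal ((W.card : ℝ) / L * P)) := by
  apply map_linear_pi
  have h := sum_partCoef_mul (Real.sqrt (n * P / L)) s W W subset_rfl
  simp_rw [← sq] at h
  have hn' : (0 : ℝ) < n := by exact_mod_cast hn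
  have hL' : (0 : ℝ) < L := by exact_mod_cast hL
  rw [h, Real.sq_sqrt (by positivity), Real.coe_toNNReal _ (by positivity)]
  push_cast
  field_simp

/-- Integration over the columns not used by the transmitted message. -/
lemma lintegral_unused {n L M : ℕ} {P σ : ℝ} (hn : 0 < n) (hP : 0 ≤ P) (hσ : 0 < σ) (hL : 0 < L)
    (t : Fin L → Fin M) (u : ℝ) (W : Finset (Fin L)) :
    ∫⁻ a', ENNReal.ofReal (Real.exp (-((u - partSum (Real.sqrt (n * P / L)) t W a') ^ 2
        / (2 * σ ^ 2)))) ∂(rowMeasure n L M) =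
      ENNReal.ofReal ((Real.sqrt (1 + (W.card : ℝ) / L * P / σ ^ 2))⁻¹ *
        Real.exp (-(u ^ 2 / (2 * (σ ^ 2 + (W.card : ℝ) / L * P))))) := by
  have h := lintegral_gaussianReal_exp_sub_sq (Real.toNNReal ((W.card : ℝ) / L * P))
    (pow_pos hσ 2) u
  rw [Real.coe_toNNReal _ (by positivity), ← map_partSum P hn hP hL t W,
    lintegral_map (by fun_prop) (by fun_prop)] at h
  exact h

/-- Random coding bound for the messages which differ from `s` exactly in the sections `W`; the
threshold `r` may depend on the columns used by `s` and on the noise. -/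
lemma random_coding_bound {n L M : ℕ} {P σ : ℝ} (hn : 0 < n) (hP : 0 ≤ P) (hσ : 0 < σ)
    (hL : 0 < L) (s : Fin L → Fin M) (W : Finset (Fin L))
    {r : (Fin L × Fin M → ℝ) × ℝ → ℝ} (hr : Measurable r)
    (hrs : ∀ a a' w, r (mixRow s (a, a'), w) = r (a, w)) {l : ℝ} (h0 : 0 ≤ l) (h1 : l ≤ 1) :
    channelMeasure n L M σ {ω | ∃ t, diffSet s t = W ∧
        ∑ i, (codeword P ω.1 s i + ω.2 i - codeword P ω.1 t i) ^ 2 / (2 * σ ^ 2) ≤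
          ∑ i, r (ω.1 i, ω.2 i)} ≤
      ENNReal.ofReal (((M : ℝ) ^ W.card * (Real.sqrt (1 + (W.card : ℝ) / L * P / σ ^ 2))⁻¹ ^ n) ^ l) *
        (∫⁻ x, ENNReal.ofReal (Real.exp (-(l * ((x.2 + partSum (Real.sqrt (n * P / L)) s W x.1) ^ 2 /
          (2 * (σ ^ 2 + (W.card : ℝ) / L * P)) - r x)))) ∂(rowNoise n L M σ)) ^ n := by
  set c := Real.sqrt (n * P / L) with hc
  set T := Finset.univ.filter fun t => diffSet s t = W with hT
  set κ := (Real.sqrt (1 + (W.card : ℝ) / L * P / σ ^ 2))⁻¹ with hκ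
  have hκ0 : 0 ≤ κ := by positivity
  set f : (Fin L → Fin M) → (Fin L × Fin M → ℝ) × ℝ → ℝ≥0∞ := fun t x =>
    ENNReal.ofReal (Real.exp (r x -
      (x.2 + (partSum c s Finset.univ x.1 - partSum c t Finset.univ x.1)) ^ 2 / (2 * σ ^ 2))) with hf
  have hfm : ∀ t, Measurable (f t) := fun t => by simp only [hf]; fun_prop
  set G : Design n L M × (Fin n → ℝ) → ℝ≥0∞ := fun ω => ∑ t ∈ T, ∏ i, f t (ω.1 i, ω.2 i) with hG
  have hGm : Measurable G := by simp only [hG]; fun_prop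
  set ψ : (Fin L × Fin M → ℝ) × ℝ → ℝ := fun x =>
    r x - (x.2 + partSum c s W x.1) ^ 2 / (2 * (σ ^ 2 + (W.card : ℝ) / L * P)) with hψ
  have hψm : Measurable ψ := by simp only [hψ]; fun_prop
  -- Markov's inequality for `G ^ l`: on the event, one summand of `G` is already at least 1.
  have step1 : channelMeasure n L M σ {ω | ∃ t, diffSet s t = W ∧
        ∑ i, (codeword P ω.1 s i + ω.2 i - codeword P ω.1 t i) ^ 2 / (2 * σ ^ 2) ≤
          ∑ i, r (ω.1 i, ω.2 i)} ≤ ∫⁻ ω, G ω ^ l ∂(channelMeasure n L M σ) := by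
    have h2 := mul_meas_ge_le_lintegral (μ := channelMeasure n L M σ) (hGm.pow_const l) 1
    rw [one_mul] at h2
    refine le_trans (measure_mono ?_) h2
    rintro ω ⟨t, htW, ht⟩
    have ht' : t ∈ T := by simp [hT, htW]
    refine one_le_exp_sum_rpow (sub_nonneg.2 ht) ?_ h0
    rw [← Finset.sum_sub_distrib, ofReal_exp_sum]
    refine le_trans (le_of_eq ?_) (Finset.single_le_sum
      (f := fun t => ∏ i, f t (ω.1 i, ω.2 i)) (fun _ _ => zero_le) ht')
    refine Finset.prod_congr rfl fun i _ => ?_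
    simp only [hf, codeword_eq_partSum]
    congr 4
    ring
  have hmix : ∀ t ∈ T, ∀ a w, ∫⁻ a', f t (mixRow s (a, a'), w) ∂(rowMeasure n L M) =
      ENNReal.ofReal κ * ENNReal.ofReal (Real.exp (ψ (a, w))) := by
    intro t ht a w
    have htW : diffSet s t = W := by simpa [hT] using ht
    have e : ∀ a', f t (mixRow s (a, a'), w) = ENNReal.ofReal (Real.exp (r (a, w))) *
        ENNReal.ofReal (Real.exp (-((w + partSum c s W a - partSum c t W a') ^ 2 / (2 * σ ^ 2)))) := by
      intro a'
      simp only [hf]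
      rw [hrs, partSum_mixRow_sub, htW, ← ENNReal.ofReal_mul (Real.exp_pos _).le, ← Real.exp_add]
      congr 2
      ring
    rw [lintegral_congr e, lintegral_const_mul _ (by fun_prop), hc,
      lintegral_unused hn hP hσ hL t _ W, ← ENNReal.ofReal_mul (Real.exp_pos _).le,
      ← ENNReal.ofReal_mul hκ0, mul_left_comm, ← Real.exp_add]
    rfl
  -- Rows are independent and each contributes `κ exp ψ`; at most `M^|W|` messages occur. Jensen is
  -- then applied to this inner average only, so the count enters to the power `l`.
  have step2 : ∀ (A : Design n L M) (w : Fin n → ℝ), ∫⁻ A', G (fun i => mixRow s (A i, A' i), w) ∂(designMeasure n L M) ≤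
      ENNReal.ofReal ((M : ℝ) ^ W.card * κ ^ n) * ∏ i, ENNReal.ofReal (Real.exp (ψ (A i, w i))) := by
    intro A w
    simp only [hG]
    rw [lintegral_finsetSum _ (fun t _ => by fun_prop)]
    have e : ∀ t ∈ T, ∫⁻ A', ∏ i, f t (mixRow s (A i, A' i), w i) ∂(designMeasure n L M) =
        ENNReal.ofReal κ ^ n * ∏ i, ENNReal.ofReal (Real.exp (ψ (A i, w i))) := by
      intro t ht
      have h3 := lintegral_prod_eq_prod_lintegral_of_indepFun Finset.univ
        (fun i (A' : Design n L M) => f t (mixRow s (A i, A' i), w i))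
        (iIndepFun_pi (μ := fun _ : Fin n => rowMeasure n L M)
          (X := fun i a' => f t (mixRow s (A i, a'), w i)) fun i => Measurable.aemeasurable (by fun_prop))
        (fun i => by fun_prop)
      refine h3.trans ?_
      have h4 : ∀ i, ∫⁻ A' : Design n L M, f t (mixRow s (A i, A' i), w i)
          ∂(Measure.pi fun _ => rowMeasure n L M) =
            ENNReal.ofReal κ * ENNReal.ofReal (Real.exp (ψ (A i, w i))) := by
        intro i
        rw [← hmix t ht]
        exact (measurePreserving_eval (fun _ : Fin n => rowMeasure n L M) i).lintegral_comp
          (f := fun a' => f t (mixRow s (A i, a'), w i)) (by fun_prop)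
      rw [Finset.prod_congr rfl fun i _ => h4 i, Finset.prod_mul_distrib]
      simp
    rw [Finset.sum_congr rfl e, Finset.sum_const, nsmul_eq_mul, ← mul_assoc,
      ENNReal.ofReal_mul (by positivity), ENNReal.ofReal_pow hκ0]
    gcongr
    rw [ENNReal.ofReal_pow (by positivity), ENNReal.ofReal_natCast]
    exact_mod_cast card_diffSet_eq_le s W
  refine step1.trans ?_
  have step3 : ∫⁻ ω, G ω ^ l ∂(channelMeasure n L M σ) ≤
      ∫⁻ ω, ENNReal.ofReal (((M : ℝ) ^ W.card * κ ^ n) ^ l) *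
        ∏ i, ENNReal.ofReal (Real.exp (l * ψ (ω.1 i, ω.2 i))) ∂(channelMeasure n L M σ) := by
    unfold channelMeasure
    rw [lintegral_prod_symm' _ (hGm.pow_const l), lintegral_prod_symm' _ (by fun_prop)]
    refine lintegral_mono fun w => ?_
    have hGw : Measurable fun A => G (A, w) := by fun_prop
    rw [← (measurePreserving_mix s).lintegral_comp (hGw.pow_const l),
      lintegral_prod _ (Measurable.aemeasurable (by fun_prop))]
    refine lintegral_mono fun A => ?_
    refine (lintegral_rpow_le (designMeasure n L M) (f := fun A' => G (fun i => mixRow s (A i, A' i), w))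
      (by fun_prop) h0 h1).trans ?_
    refine (ENNReal.rpow_le_rpow (step2 A w) h0).trans (le_of_eq ?_)
    rw [ENNReal.mul_rpow_of_nonneg _ _ h0, ENNReal.ofReal_rpow_of_nonneg (by positivity) h0]
    congr 1
    rw [← ENNReal.prod_rpow_of_nonneg h0]
    refine Finset.prod_congr rfl fun i _ => ?_
    rw [ENNReal.ofReal_rpow_of_nonneg (Real.exp_pos _).le h0, ← Real.exp_mul, mul_comm]
  refine step3.trans (le_of_eq ?_)
  rw [lintegral_const_mul _ (by fun_prop),
    lintegral_channel_prod σ (f := fun x => ENNReal.ofReal (Real.exp (l * ψ x))) (by fun_prop)]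
  congr 3
  funext x
  simp only [hψ]
  congr 2
  ring

/-- The noise plus the `b`-form is independent of the `c`-form, and `C/(σ²+B+C)` is one minus the
squared correlation of the two squared variables. Both bounds on `errEvent` are instances. -/
lemma lintegral_rowNoise_exp {n L M : ℕ} {σ : ℝ} (hσ : 0 < σ) (b c : Fin L × Fin M → ℝ) {B C : ℝ}
    (hB : B = (n : ℝ)⁻¹ * ∑ j, b j ^ 2) (hC : C = (n : ℝ)⁻¹ * ∑ j, c j ^ 2)
    (hbc : ∑ j, b j * c j = 0) {l : ℝ} (hl : 0 ≤ l) (hl1 : l ^ 2 * (C / (σ ^ 2 + B + C)) < 1) :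
    ∫⁻ x, ENNReal.ofReal (Real.exp (-(l * ((x.2 + ∑ j, b j * x.1 j + ∑ j, c j * x.1 j) ^ 2 /
        (2 * (σ ^ 2 + B + C)) - (x.2 + ∑ j, b j * x.1 j) ^ 2 / (2 * (σ ^ 2 + B))))))
        ∂(rowNoise n L M σ) =
      ENNReal.ofReal ((Real.sqrt (1 - l ^ 2 * (C / (σ ^ 2 + B + C))))⁻¹) := by
  have hB0 : 0 ≤ B := by rw [hB]; positivity
  have hC0 : 0 ≤ C := by rw [hC]; positivity
  have h := lintegral_noisy_linear_pair ((n : ℝ≥0)⁻¹) (Real.toNNReal (σ ^ 2)) b c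
    (Real.toNNReal B) (Real.toNNReal C)
    (by rw [Real.coe_toNNReal _ hB0, hB]; push_cast; rfl)
    (by rw [Real.coe_toNNReal _ hC0, hC]; push_cast; rfl) hbc
    (F := fun z y => ENNReal.ofReal (Real.exp (-(l * ((z + y) ^ 2 / (2 * (σ ^ 2 + B + C)) -
      z ^ 2 / (2 * (σ ^ 2 + B))))))) (by unfold Function.uncurry; fun_prop)
  refine h.trans ?_
  have hA : ((Real.toNNReal (σ ^ 2) + Real.toNNReal B : ℝ≥0) : ℝ) = σ ^ 2 + B := by
    rw [NNReal.coe_add, Real.coe_toNNReal _ (by positivity), Real.coe_toNNReal _ hB0]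
  have h2 := lintegral_exp_sq_sub_sq (Real.toNNReal (σ ^ 2) + Real.toNNReal B) (Real.toNNReal C)
    (add_pos_of_pos_of_nonneg (Real.toNNReal_pos.2 (by positivity)) (zero_le)) hl
    (by rwa [hA, Real.coe_toNNReal _ hC0])
  rwa [hA, Real.coe_toNNReal _ hC0] at h2

lemma inv_sqrt_eq_exp {y : ℝ} (hy : 0 < y) :
    (Real.sqrt y)⁻¹ = Real.exp (-(1 / 2 * Real.log y)) := by
  rw [Real.exp_neg, show 1 / 2 * Real.log y = Real.log (Real.sqrt y) by
    rw [Real.log_sqrt hy.le]; ring, Real.exp_log (Real.sqrt_pos.2 hy)]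

/-- The event that a message at section distance `l` from `s` is at least as close to the channel
output as `s`, up to a random threshold. -/
lemma random_coding_union {n L M : ℕ} {P σ R : ℝ} (hn : 0 < n) (hP : 0 ≤ P) (hσ : 0 < σ)
    (hL : 0 < L) (hM : 0 < M) (hR : (L : ℝ) * Real.log M = n * R) (s : Fin L → Fin M) (k : ℕ)
    {r : (Fin L × Fin M → ℝ) × ℝ → ℝ} (hr : Measurable r)
    (hrs : ∀ a a' w, r (mixRow s (a, a'), w) = r (a, w)) {l e : ℝ} (h0 : 0 ≤ l) (h1 : l ≤ 1)
    (he : ∀ W : Finset (Fin L), W.card = k →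
      ∫⁻ x, ENNReal.ofReal (Real.exp (-(l * ((x.2 + partSum (Real.sqrt (n * P / L)) s W x.1) ^ 2 /
          (2 * (σ ^ 2 + (k : ℝ) / L * P)) - r x)))) ∂(rowNoise n L M σ) ≤
        ENNReal.ofReal (Real.exp (-e))) :
    channelMeasure n L M σ {ω | ∃ t, (diffSet s t).card = k ∧
        ∑ i, (codeword P ω.1 s i + ω.2 i - codeword P ω.1 t i) ^ 2 / (2 * σ ^ 2) ≤
          ∑ i, r (ω.1 i, ω.2 i)} ≤
      ENNReal.ofReal ((L.choose k : ℝ) *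
        Real.exp (-(n * (l * (capAt (P / σ ^ 2) ((k : ℝ) / L) - (k : ℝ) / L * R) + e)))) := by
  have hL0 : (0 : ℝ) < L := by exact_mod_cast hL
  have hM0 : (0 : ℝ) < M := by exact_mod_cast hM
  calc channelMeasure n L M σ {ω | ∃ t, (diffSet s t).card = k ∧
        ∑ i, (codeword P ω.1 s i + ω.2 i - codeword P ω.1 t i) ^ 2 / (2 * σ ^ 2) ≤
          ∑ i, r (ω.1 i, ω.2 i)}
      ≤ channelMeasure n L M σ (⋃ W ∈ Finset.powersetCard k (Finset.univ : Finset (Fin L)),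
          {ω | ∃ t, diffSet s t = W ∧
            ∑ i, (codeword P ω.1 s i + ω.2 i - codeword P ω.1 t i) ^ 2 / (2 * σ ^ 2) ≤
              ∑ i, r (ω.1 i, ω.2 i)}) := by
        apply measure_mono
        rintro ω ⟨t, ht, h⟩
        simp only [Set.mem_iUnion]
        exact ⟨diffSet s t, Finset.mem_powersetCard.2 ⟨Finset.subset_univ _, ht⟩, t, rfl, h⟩
    _ ≤ ∑ W ∈ Finset.powersetCard k (Finset.univ : Finset (Fin L)), channelMeasure n L M σ
          {ω | ∃ t, diffSet s t = W ∧
            ∑ i, (codeword P ω.1 s i + ω.2 i - codeword P ω.1 t i) ^ 2 / (2 * σ ^ 2) ≤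
              ∑ i, r (ω.1 i, ω.2 i)} := measure_biUnion_finset_le _ _
    _ ≤ ∑ W ∈ Finset.powersetCard k (Finset.univ : Finset (Fin L)), ENNReal.ofReal
        (Real.exp (-(n * (l * (capAt (P / σ ^ 2) ((k : ℝ) / L) - (k : ℝ) / L * R) + e)))) := by
        refine Finset.sum_le_sum fun W hW => ?_
        have hk := (Finset.mem_powersetCard.1 hW).2
        refine (random_coding_bound hn hP hσ hL s W hr hrs h0 h1).trans ?_
        rw [hk]
        refine (mul_le_mul_right (pow_le_pow_left₀ (zero_le) (he W hk) n) _).trans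
          (le_of_eq ?_)
        rw [← ENNReal.ofReal_pow (Real.exp_pos _).le, ← ENNReal.ofReal_mul (by positivity),
          inv_sqrt_eq_exp (by positivity)]
        congr 1
        have hMk : (M : ℝ) ^ k = Real.exp (n * ((k : ℝ) / L * R)) := by
          rw [← Real.exp_log hM0, ← Real.exp_nat_mul]
          congr 1
          have : (n : ℝ) * (k / L * R) = k / L * (n * R) := by ring
          rw [this, ← hR]; field_simp
        rw [hMk, ← Real.exp_nat_mul, ← Real.exp_add, ← Real.exp_mul, ← Real.exp_nat_mul,
          ← Real.exp_add]
        congr 1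
        unfold capAt
        rw [mul_div_assoc]
        ring
    _ = _ := by
        rw [Finset.sum_const, Finset.card_powersetCard, Finset.card_univ, Fintype.card_fin,
          nsmul_eq_mul, ENNReal.ofReal_mul (by positivity), ENNReal.ofReal_natCast]

/-! ### The unrefined and the refined bound for a given number of wrong sections. -/

/-- Some message at section distance `k` from `s` is at least as close to the channel output. -/
def errEvent (n : ℕ) {L M : ℕ} (P : ℝ) (s : Fin L → Fin M) (k : ℕ) :
    Set (Design n L M × (Fin n → ℝ)) :=
  {ω | ∃ t, (diffSet s t).card = k ∧
    ∑ i, (codeword P ω.1 s i + ω.2 i - codeword P ω.1 t i) ^ 2 ≤ ∑ i, ω.2 i ^ 2}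

lemma inv_mul_sum_partCoef {n L M : ℕ} {P : ℝ} (hn : 0 < n) (hP : 0 ≤ P) (hL : 0 < L)
    (s : Fin L → Fin M) {W V : Finset (Fin L)} (h : W ⊆ V) :
    (n : ℝ)⁻¹ * ∑ j, partCoef (Real.sqrt (n * P / L)) s W j * partCoef (Real.sqrt (n * P / L)) s V j
      = (W.card : ℝ) / L * P := by
  have hn' : (0 : ℝ) < n := by exact_mod_cast hn
  have hL' : (0 : ℝ) < L := by exact_mod_cast hL
  rw [sum_partCoef_mul _ _ _ _ h, Real.sq_sqrt (by positivity)]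
  field_simp

lemma errEvent_le_untruncated {n L M : ℕ} {P σ R : ℝ} (hn : 0 < n) (hP : 0 ≤ P) (hσ : 0 < σ)
    (hL : 0 < L) (hM : 0 < M) (hR : (L : ℝ) * Real.log M = n * R) (s : Fin L → Fin M) (k : ℕ)
    {l α S : ℝ} (h0 : 0 ≤ l) (h1 : l ≤ 1) (hα : α = (k : ℝ) / L) (hS : S = P / σ ^ 2) :
    channelMeasure n L M σ (errEvent n P s k) ≤
      ENNReal.ofReal ((L.choose k : ℝ) * Real.exp (-(n * (l * (capAt S α - α * R) +
        1 / 2 * Real.log (1 - l ^ 2 * (α * S / (1 + α * S))))))) := by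
  have hα0 : 0 ≤ α := by rw [hα]; positivity
  have hσ2 : 0 < σ ^ 2 := by positivity
  have hS0 : 0 ≤ S := by rw [hS]; positivity
  have hrat : α * P / (σ ^ 2 + 0 + α * P) = α * S / (1 + α * S) := by rw [hS]; field_simp; ring
  have hlt : α * S / (1 + α * S) < 1 := by
    rw [div_lt_one (by positivity)]; linarith
  have hpos := one_sub_sq_mul_pos h0 h1 (by positivity : 0 ≤ α * S / (1 + α * S)) hlt
  rw [hS, hα]
  refine le_trans (measure_mono ?_) (random_coding_union hn hP hσ hL hM hR s k
    (r := fun x => x.2 ^ 2 / (2 * σ ^ 2)) (by fun_prop) (fun _ _ _ => rfl) h0 h1 fun W hW => ?_)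
  · rintro ω ⟨t, ht, h⟩
    refine ⟨t, ht, ?_⟩
    rw [← Finset.sum_div, ← Finset.sum_div]
    gcongr
  · rw [← hα, ← hS, ← inv_sqrt_eq_exp hpos, ← hrat]
    have hC := inv_mul_sum_partCoef hn hP hL s (subset_refl W)
    rw [hW, ← hα] at hC
    rw [← lintegral_rowNoise_exp (n := n) (M := M) hσ (fun _ => 0)
      (partCoef (Real.sqrt (n * P / L)) s W) (by simp) (by simp_rw [sq]; exact hC.symm) (by simp) h0
      (by rw [hrat]; linarith)]
    simp [partSum]

lemma partSum_mixRow {L M : ℕ} (c : ℝ) (s : Fin L → Fin M) (W : Finset (Fin L))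
    (a a' : Fin L × Fin M → ℝ) : partSum c s W (mixRow s (a, a')) = partSum c s W a := by
  refine Finset.sum_congr rfl fun j _ => ?_
  simp only [partCoef, mixRow]
  split_ifs <;> simp_all

/-- `α` is the regression coefficient of the wrong-section sum on the full codeword symbol. The
residual is thus uncorrelated with the reference variable and has variance `α(1-α)P` instead of
`αP`. The second term is the Chernoff bound, with tilt `m`, for the noise energy exceeding the
threshold. -/
lemma errEvent_le_truncated {n L M : ℕ} {P σ R : ℝ} (hn : 0 < n) (hP : 0 ≤ P) (hσ : 0 < σ)
    (hL : 0 < L) (hM : 0 < M) (hR : (L : ℝ) * Real.log M = n * R) (s : Fin L → Fin M) (k : ℕ)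
    (hk : k ≤ L) {l m τ α S : ℝ} (h0 : 0 ≤ l) (h1 : l ≤ 1) (hα : α = (k : ℝ) / L)
    (hS : S = P / σ ^ 2) (hm0 : 0 ≤ m) (hm1 : m ^ 2 * (α ^ 2 * S / (1 + α ^ 2 * S)) < 1) :
    channelMeasure n L M σ (errEvent n P s k) ≤
      ENNReal.ofReal ((L.choose k : ℝ) * Real.exp (-(n * (l * (capAt S α - α * R - τ) +
        1 / 2 * Real.log (1 - l ^ 2 * (α * (1 - α) * S / (1 + α * S)))))) +
        Real.exp (-(n * (m * τ + 1 / 2 * Real.log (1 - m ^ 2 * (α ^ 2 * S / (1 + α ^ 2 * S))))))) := by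
  have hL0 : (0 : ℝ) < L := by exact_mod_cast hL
  have hα0 : 0 ≤ α := by rw [hα]; positivity
  have hα1 : α ≤ 1 := by rw [hα, div_le_one hL0]; exact_mod_cast hk
  have h1α : 0 ≤ 1 - α := by linarith
  have hσ2 : 0 < σ ^ 2 := by positivity
  have hS0 : 0 ≤ S := by rw [hS]; positivity
  set c := Real.sqrt (n * P / L) with hc
  set r : (Fin L × Fin M → ℝ) × ℝ → ℝ := fun x =>
    (x.2 + α * partSum c s Finset.univ x.1) ^ 2 / (2 * (σ ^ 2 + α ^ 2 * P)) + τ with hr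
  have hrat : α * (1 - α) * P / (σ ^ 2 + α ^ 2 * P + α * (1 - α) * P)
      = α * (1 - α) * S / (1 + α * S) := by
    have : σ ^ 2 + α ^ 2 * P + α * (1 - α) * P = σ ^ 2 + α * P := by ring
    rw [this, hS]; field_simp
  have hrat2 : α ^ 2 * P / (σ ^ 2 + 0 + α ^ 2 * P) = α ^ 2 * S / (1 + α ^ 2 * S) := by
    rw [hS]; field_simp; ring
  have hlt : α * (1 - α) * S / (1 + α * S) < 1 := by
    rw [div_lt_one (by positivity)]; nlinarith [mul_nonneg hα0 (mul_nonneg hα0 hS0)]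
  have hpos := one_sub_sq_mul_pos h0 h1 (by positivity : 0 ≤ α * (1 - α) * S / (1 + α * S)) hlt
  have hU := inv_mul_sum_partCoef hn hP hL s (subset_refl (Finset.univ : Finset (Fin L)))
  rw [Finset.card_univ, Fintype.card_fin, div_self hL0.ne', one_mul, ← hc] at hU
  have hsplit : errEvent n P s k ⊆ {ω | ∃ t, (diffSet s t).card = k ∧
        ∑ i, (codeword P ω.1 s i + ω.2 i - codeword P ω.1 t i) ^ 2 / (2 * σ ^ 2) ≤
          ∑ i, r (ω.1 i, ω.2 i)} ∪
      {ω | 1 ≤ ∏ i, ENNReal.ofReal (Real.exp (m * (ω.2 i ^ 2 / (2 * σ ^ 2) - r (ω.1 i, ω.2 i))))} := by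
    rintro ω ⟨t, ht, h⟩
    rcases le_or_gt (∑ i, ω.2 i ^ 2 / (2 * σ ^ 2)) (∑ i, r (ω.1 i, ω.2 i)) with h2 | h2
    · left
      refine ⟨t, ht, le_trans ?_ h2⟩
      rw [← Finset.sum_div, ← Finset.sum_div]
      gcongr
    · right
      simp only [Set.mem_ofPred_eq]
      rw [← ofReal_exp_sum, ENNReal.one_le_ofReal, ← Finset.mul_sum, Finset.sum_sub_distrib]
      exact Real.one_le_exp (mul_nonneg hm0 (by linarith))
  rw [ENNReal.ofReal_add (by positivity) (by positivity)]
  refine ((measure_mono hsplit).trans (measure_union_le _ _)).trans (add_le_add ?_ ?_)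
  · have hmain := random_coding_union hn hP hσ hL hM hR s k (r := r) (by simp only [hr]; fun_prop)
      (fun a a' w => by
        simp only [hr, partSum_mixRow]) (l := l)
      (e := -(l * τ) + 1 / 2 * Real.log (1 - l ^ 2 * (α * (1 - α) * S / (1 + α * S)))) h0 h1
      fun W hW => ?_
    · rw [← hα, ← hS] at hmain
      refine hmain.trans (le_of_eq ?_)
      congr 5
      ring
    · have hC := inv_mul_sum_partCoef hn hP hL s (subset_refl W)
      have hWU := inv_mul_sum_partCoef hn hP hL s (Finset.subset_univ W)
      rw [hW, ← hα, ← hc] at hC hWU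
      have hn' : (n : ℝ)⁻¹ ≠ 0 := by
        have : (n : ℝ) ≠ 0 := by exact_mod_cast hn.ne'
        positivity
      have key := lintegral_rowNoise_exp (n := n) (M := M) hσ
        (fun j => α * partCoef c s Finset.univ j)
        (fun j => partCoef c s W j - α * partCoef c s Finset.univ j)
        (B := α ^ 2 * P) (C := α * (1 - α) * P)
        (by
          simp_rw [mul_pow, ← Finset.mul_sum, sq (partCoef _ _ _ _)]
          rw [mul_left_comm, hU])
        (by
          have : ∀ j, (partCoef c s W j - α * partCoef c s Finset.univ j) ^ 2 =
            partCoef c s W j * partCoef c s W j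
              - 2 * α * (partCoef c s W j * partCoef c s Finset.univ j)
              + α ^ 2 * (partCoef c s Finset.univ j * partCoef c s Finset.univ j) := fun j => by ring
          simp_rw [this]
          rw [Finset.sum_add_distrib, Finset.sum_sub_distrib, ← Finset.mul_sum, ← Finset.mul_sum]
          linear_combination -hC + 2 * α * hWU - α ^ 2 * hU)
        (by
          have : ∀ j, α * partCoef c s Finset.univ j *
              (partCoef c s W j - α * partCoef c s Finset.univ j) =
              α * (partCoef c s W j * partCoef c s Finset.univ j)
              - α ^ 2 * (partCoef c s Finset.univ j * partCoef c s Finset.univ j) := fun j => by ring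
          simp_rw [this]
          refine (mul_eq_zero.1 ?_).resolve_left hn'
          rw [Finset.sum_sub_distrib, ← Finset.mul_sum, ← Finset.mul_sum]
          linear_combination α * hWU - α ^ 2 * hU) h0 (by rw [hrat]; linarith)
      rw [hrat, show σ ^ 2 + α ^ 2 * P + α * (1 - α) * P = σ ^ 2 + α * P by ring] at key
      rw [neg_add, neg_neg, Real.exp_add, ← inv_sqrt_eq_exp hpos,
        ENNReal.ofReal_mul (Real.exp_pos _).le, ← key, ← lintegral_const_mul _ (by fun_prop)]
      refine le_of_eq (lintegral_congr fun x => ?_)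
      rw [← ENNReal.ofReal_mul (Real.exp_pos _).le, ← Real.exp_add, ← hα, ← hc]
      congr 2
      simp only [hr, partSum, sub_mul, mul_assoc, Finset.sum_sub_distrib, ← Finset.mul_sum]
      ring
  · have hmeas : Measurable fun x : (Fin L × Fin M → ℝ) × ℝ =>
        ENNReal.ofReal (Real.exp (m * (x.2 ^ 2 / (2 * σ ^ 2) - r x))) := by
      simp only [hr]; fun_prop
    have h2 := mul_meas_ge_le_lintegral (μ := channelMeasure n L M σ)
      (f := fun ω => ∏ i, ENNReal.ofReal (Real.exp (m * (ω.2 i ^ 2 / (2 * σ ^ 2) - r (ω.1 i, ω.2 i)))))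
      (by simp only [hr]; fun_prop) 1
    rw [one_mul] at h2
    refine h2.trans ?_
    rw [lintegral_channel_prod σ hmeas]
    have key := lintegral_rowNoise_exp (n := n) (M := M) hσ (fun _ => 0)
      (fun j => α * partCoef c s Finset.univ j) (B := 0) (C := α ^ 2 * P) (by simp)
      (by
        simp_rw [mul_pow, ← Finset.mul_sum, sq (partCoef _ _ _ _)]
        rw [mul_left_comm, hU]) (by simp) hm0 (by rwa [hrat2])
    rw [hrat2] at key
    have e : ∀ x : (Fin L × Fin M → ℝ) × ℝ,
        ENNReal.ofReal (Real.exp (m * (x.2 ^ 2 / (2 * σ ^ 2) - r x))) =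
        ENNReal.ofReal (Real.exp (-(m * τ))) * ENNReal.ofReal (Real.exp (-(m * ((x.2 +
          ∑ j, (fun _ => (0 : ℝ)) j * x.1 j + ∑ j, α * partCoef c s Finset.univ j * x.1 j) ^ 2 /
          (2 * (σ ^ 2 + 0 + α ^ 2 * P)) -
          (x.2 + ∑ j, (fun _ => (0 : ℝ)) j * x.1 j) ^ 2 / (2 * (σ ^ 2 + 0)))))) := by
      intro x
      rw [← ENNReal.ofReal_mul (Real.exp_pos _).le, ← Real.exp_add]
      congr 2
      simp only [hr, partSum, mul_assoc, zero_mul, Finset.sum_const_zero, add_zero,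
        ← Finset.mul_sum]
      ring
    rw [lintegral_congr e, lintegral_const_mul _ (by fun_prop), key,
      inv_sqrt_eq_exp (by linarith), ← ENNReal.ofReal_mul (Real.exp_pos _).le, ← Real.exp_add,
      ← ENNReal.ofReal_pow (Real.exp_pos _).le, ← Real.exp_nat_mul]
    refine le_of_eq ?_
    congr 2
    ring

/-! ### Minimum distance of shortened Reed–Solomon codes. -/

section ReedSolomon

variable {F : Type*} [Field F]

/-- Two codewords of a Reed-Solomon code of dimension `k` which agree in `k` places coincide. -/
lemma rsEncode_injective_of_agree [DecidableEq F] {N k : ℕ} (hk : k ≤ N) {pts : Fin N → F}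
    (hpts : Function.Injective pts) {u u' : Fin k → F}
    (h : k ≤ (Finset.univ.filter fun i => rsEncode hk pts u i = rsEncode hk pts u' i).card) :
    u = u' := by
  obtain ⟨p, hp, hpe⟩ := rsEncode_eq_eval hk hpts u
  obtain ⟨p', hp', hpe'⟩ := rsEncode_eq_eval hk hpts u'
  have hlt : (k : WithBot ℕ) ≤
      ((Finset.univ.filter fun i => rsEncode hk pts u i = rsEncode hk pts u' i).card : ℕ) := by
    exact_mod_cast h
  have hpp : p = p' := by
    refine Polynomial.eq_of_degrees_lt_of_eval_index_eq
      (Finset.univ.filter fun i => rsEncode hk pts u i = rsEncode hk pts u' i) (v := pts)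
      hpts.injOn (hp.trans_le hlt) (hp'.trans_le hlt) fun i hi => ?_
    rw [← hpe, ← hpe']
    exact (Finset.mem_filter.1 hi).2
  funext j
  rw [← rsEncode_systematic hk hpts u j, ← rsEncode_systematic hk hpts u' j, hpe, hpe', hpp]

/-- The minimum distance of a shortened Reed-Solomon code. -/
lemma lt_hammingDist_shortRS [DecidableEq F] {L M k : ℕ} (hLM : L ≤ M) (hk : k ≤ M)
    {pts : Fin M → F} (hpts : Function.Injective pts) {v v' : Fin (k - (M - L)) → F}
    (hv : v ≠ v') :
    L < hammingDist (shortRS hLM hk pts v) (shortRS hLM hk pts v') + (k - (M - L)) := by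
  classical
  have hkML : M - L < k := by
    by_contra hcon
    exact hv (funext fun j => absurd j.2 (by omega))
  set u : (Fin (k - (M - L)) → F) → Fin k → F := fun v i =>
    if h : M - L ≤ i.1 then v ⟨i.1 - (M - L), by omega⟩ else 0 with hu
  set S := Finset.univ.filter fun i => rsEncode hk pts (u v) i = rsEncode hk pts (u v') i with hS
  set G := Finset.univ.filter fun l => shortRS hLM hk pts v l = shortRS hLM hk pts v' l with hG
  have huv : u v ≠ u v' := by
    intro h
    apply hv
    funext j
    have e : ∀ v, u v ⟨M - L + j.1, by omega⟩ = v j := fun v => by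
      simp only [hu]
      rw [dif_pos (Nat.le_add_right _ _)]
      exact congrArg v (Fin.ext (Nat.add_sub_cancel_left _ _))
    rw [← e v, ← e v', h]
  have hScard : S.card < k := by
    by_contra hcon
    exact huv (rsEncode_injective_of_agree hk hpts (not_lt.1 hcon))
  let e₁ : Fin (M - L) ↪ Fin M := ⟨fun i => ⟨i.1, by omega⟩, fun i j h => by
    simpa [Fin.ext_iff] using h⟩
  let e₂ : Fin L ↪ Fin M := ⟨fun i => ⟨M - L + i.1, by omega⟩, fun i j h => by
    simpa [Fin.ext_iff] using h⟩
  -- The `M - L` zeroed systematic positions always agree, so fewer than `k - (M - L)` kept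
  -- positions can.
  have hsub : (Finset.univ.map e₁) ∪ (G.map e₂) ⊆ S := by
    intro i hi
    rw [hS, Finset.mem_filter]
    refine ⟨Finset.mem_univ _, ?_⟩
    rcases Finset.mem_union.1 hi with h | h
    · obtain ⟨j, _, rfl⟩ := Finset.mem_map.1 h
      have hj : e₁ j = Fin.castLE hk ⟨j.1, by omega⟩ := rfl
      have hnot : ¬ (M - L ≤ j.1) := by omega
      rw [hj, rsEncode_systematic hk hpts, rsEncode_systematic hk hpts]
      simp only [hu]
      rw [dif_neg hnot, dif_neg hnot]
    · obtain ⟨j, hj, rfl⟩ := Finset.mem_map.1 h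
      exact (Finset.mem_filter.1 hj).2
  have hdisj : Disjoint (Finset.univ.map e₁) (G.map e₂) := by
    rw [Finset.disjoint_left]
    intro i h1 h2
    obtain ⟨a, _, rfl⟩ := Finset.mem_map.1 h1
    obtain ⟨b, _, hb⟩ := Finset.mem_map.1 h2
    have h3 : M - L + b.1 = a.1 := congrArg Fin.val hb
    omega
  have hcard := Finset.card_le_card hsub
  rw [Finset.card_union_of_disjoint hdisj, Finset.card_map, Finset.card_map, Finset.card_univ,
    Fintype.card_fin] at hcard
  have hsum : G.card + hammingDist (shortRS hLM hk pts v) (shortRS hLM hk pts v') = L := by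
    have := Finset.card_filter_add_card_filter_not (s := (Finset.univ : Finset (Fin L)))
      (fun l => shortRS hLM hk pts v l = shortRS hLM hk pts v' l)
    rw [Finset.card_univ, Fintype.card_fin] at this
    exact this
  omega

/-- Minimum distance decoding corrects fewer than half the minimum distance many errors. -/
lemma minDistDecoder_eq [DecidableEq F] {L M k : ℕ} (hLM : L ≤ M) (hk : k ≤ M)
    {pts : Fin M → F} (hpts : Function.Injective pts) {out : (Fin L → F) → (Fin (k - (M - L)) → F)}
    (hout : IsMinDistDecoder (shortRS hLM hk pts) out) (r : Fin L → F) (v : Fin (k - (M - L)) → F)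
    (h : k - (M - L) = 0 ∨ 2 * hammingDist r (shortRS hLM hk pts v) + (k - (M - L)) ≤ L) :
    out r = v := by
  by_contra hne
  rcases h with h | h
  · exact hne (funext fun j => absurd j.2 (by omega))
  have h1 := lt_hammingDist_shortRS hLM hk hpts hne
  have h2 := hout r v
  have h3 := hammingDist_triangle (shortRS hLM hk pts (out r)) r (shortRS hLM hk pts v)
  rw [hammingDist_comm (shortRS hLM hk pts (out r)) r] at h3
  omega

end ReedSolomon

/-! ### Ties are null, and all messages are equivalent. -/

lemma linear_pi_null {ι : Type*} [Fintype ι] {v : ℝ≥0} (hv : v ≠ 0) {b : ι → ℝ} (hb : b ≠ 0)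
    (x : ℝ) : (Measure.pi fun _ : ι => gaussianReal 0 v) {a | ∑ i, b i * a i = x} = 0 := by
  obtain ⟨i, hi⟩ := Function.ne_iff.1 hb
  have hpos : 0 < ∑ i, b i ^ 2 :=
    Finset.sum_pos' (fun i _ => sq_nonneg _) ⟨i, Finset.mem_univ _, by
      have : b i ≠ 0 := hi
      positivity⟩
  have hv0 : (0 : ℝ) < v := by exact_mod_cast pos_iff_ne_zero.2 hv
  obtain ⟨B, hB⟩ : ∃ B : ℝ≥0, (B : ℝ) = v * ∑ i, b i ^ 2 :=
    ⟨⟨v * ∑ i, b i ^ 2, by positivity⟩, rfl⟩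
  have hB0 : B ≠ 0 := by
    have : (0 : ℝ) < B := by rw [hB]; positivity
    exact_mod_cast this.ne'
  have hm : Measurable fun a : ι → ℝ => ∑ i, b i * a i := by fun_prop
  have := nullSingletonClass_gaussianReal (μ := 0) hB0
  have h := measure_singleton (μ := gaussianReal 0 B) x
  rw [← map_linear_pi v b B hB, Measure.map_apply hm (measurableSet_singleton x)] at h
  exact h

/-- Almost surely no two messages are equally close to the channel output. -/
lemma tie_null {n L M : ℕ} {P σ : ℝ} (hn : 0 < n) (hP : 0 < P) (hσ : 0 < σ) (hL : 0 < L)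
    (s t t' : Fin L → Fin M) (htt : t ≠ t') :
    channelMeasure n L M σ {ω | ∑ i, (codeword P ω.1 s i + ω.2 i - codeword P ω.1 t i) ^ 2 =
      ∑ i, (codeword P ω.1 s i + ω.2 i - codeword P ω.1 t' i) ^ 2} = 0 := by
  have hm := fun s => measurable_codeword (n := n) (L := L) (M := M) P s
  have hmeas : MeasurableSet {ω : Design n L M × (Fin n → ℝ) |
      ∑ i, (codeword P ω.1 s i + ω.2 i - codeword P ω.1 t i) ^ 2 =
      ∑ i, (codeword P ω.1 s i + ω.2 i - codeword P ω.1 t' i) ^ 2} := by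
    have h1 : ∀ u : Fin L → Fin M, Measurable fun ω : Design n L M × (Fin n → ℝ) =>
        ∑ i, (codeword P ω.1 s i + ω.2 i - codeword P ω.1 u i) ^ 2 := by
      intro u
      refine Finset.measurable_sum _ fun i _ => ?_
      exact ((((hm s i).comp measurable_fst).add ((measurable_pi_apply i).comp measurable_snd)).sub
        ((hm u i).comp measurable_fst)).pow_const 2
    exact measurableSet_eq_fun (h1 t) (h1 t')
  set c := Real.sqrt (n * P / L) with hc
  have hn0 : (0 : ℝ) < n := by exact_mod_cast hn
  have hL0 : (0 : ℝ) < L := by exact_mod_cast hL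
  have hc0 : c ≠ 0 := by rw [hc]; positivity
  obtain ⟨l, hl⟩ := Function.ne_iff.1 htt
  have hb : (fun j => partCoef c t Finset.univ j - partCoef c t' Finset.univ j) ≠ 0 := by
    refine Function.ne_iff.2 ⟨(l, t l), ?_⟩
    simp [partCoef, hl, hc0]
  have hrow := linear_pi_null (v := (n : ℝ≥0)⁻¹) (by
    have : (n : ℝ≥0) ≠ 0 := by exact_mod_cast hn.ne'
    positivity) hb 0
  have hdes : ∀ᵐ A ∂(designMeasure n L M), codeword P A t ⟨0, hn⟩ ≠ codeword P A t' ⟨0, hn⟩ := by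
    rw [ae_iff]
    refine measure_mono_null ?_ ((measurePreserving_eval (fun _ : Fin n => rowMeasure n L M)
      ⟨0, hn⟩).quasiMeasurePreserving.preimage_null hrow)
    intro A hA
    simp only [ne_eq, not_not, Set.mem_ofPred_eq, codeword_eq_partSum] at hA
    simp only [Set.mem_preimage, Set.mem_ofPred_eq, sub_mul, Finset.sum_sub_distrib]
    exact sub_eq_zero.2 hA
  refine Measure.measure_prod_null_of_ae_null hmeas ?_
  -- For fixed `A` the squares of the noise cancel, and a tie is a nontrivial affine equation in the
  -- noise.
  filter_upwards [hdes] with A hA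
  have hd : (fun i => 2 * (codeword P A t' i - codeword P A t i)) ≠ 0 := by
    refine Function.ne_iff.2 ⟨⟨0, hn⟩, ?_⟩
    simpa [sub_eq_zero] using hA.symm
  refine measure_mono_null ?_ (linear_pi_null (v := Real.toNNReal (σ ^ 2))
    (Real.toNNReal_pos.2 (by positivity)).ne' hd
    (∑ i, ((codeword P A s i - codeword P A t' i) ^ 2 - (codeword P A s i - codeword P A t i) ^ 2)))
  intro w hw
  simp only [Set.mem_preimage, Set.mem_ofPred_eq] at hw ⊢
  rw [← sub_eq_zero, ← Finset.sum_sub_distrib] at hw ⊢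
  rw [← hw]
  refine Finset.sum_congr rfl fun i _ => ?_
  ring

/-- Some message with section error rate at least `ε` is closest to the channel output. -/
def minEvent (n : ℕ) {L M : ℕ} (P ε : ℝ) (s : Fin L → Fin M) :
    Set (Design n L M × (Fin n → ℝ)) :=
  {ω | ∃ t, ε ≤ sectionErrorRate s t ∧ ∀ t',
    ∑ i, (codeword P ω.1 s i + ω.2 i - codeword P ω.1 t i) ^ 2 ≤
      ∑ i, (codeword P ω.1 s i + ω.2 i - codeword P ω.1 t' i) ^ 2}

lemma measurableSet_minEvent (n : ℕ) {L M : ℕ} (P ε : ℝ) (s : Fin L → Fin M) :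
    MeasurableSet (minEvent n P ε s) := by
  have hm := fun s => measurable_codeword (n := n) (L := L) (M := M) P s
  have h1 : ∀ u : Fin L → Fin M, Measurable fun ω : Design n L M × (Fin n → ℝ) =>
      ∑ i, (codeword P ω.1 s i + ω.2 i - codeword P ω.1 u i) ^ 2 := by
    intro u
    refine Finset.measurable_sum _ fun i _ => ?_
    exact ((((hm s i).comp measurable_fst).add ((measurable_pi_apply i).comp measurable_snd)).sub
      ((hm u i).comp measurable_fst)).pow_const 2
  have : minEvent n P ε s = ⋃ t : Fin L → Fin M, ⋃ _ : ε ≤ sectionErrorRate s t,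
      ⋂ t' : Fin L → Fin M, {ω : Design n L M × (Fin n → ℝ) |
        ∑ i, (codeword P ω.1 s i + ω.2 i - codeword P ω.1 t i) ^ 2 ≤
        ∑ i, (codeword P ω.1 s i + ω.2 i - codeword P ω.1 t' i) ^ 2} := by
    ext ω; simp [minEvent]
  rw [this]
  exact MeasurableSet.iUnion fun t => MeasurableSet.iUnion fun _ => MeasurableSet.iInter fun t' =>
    measurableSet_le (h1 t) (h1 t')

/-- `dec` may break ties arbitrarily, even non-measurably. Up to ties its error event is `minEvent`,
which is measurable and independent of the decoder, so the column symmetry applies to it. -/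
lemma measure_decoder_eq_minEvent {n L M : ℕ} {P σ : ℝ} (hn : 0 < n) (hP : 0 < P) (hσ : 0 < σ)
    (hL : 0 < L) {dec : Design n L M → (Fin n → ℝ) → (Fin L → Fin M)}
    (hdec : IsOptimalDecoder P dec) (ε : ℝ) (s : Fin L → Fin M) :
    channelMeasure n L M σ {ω | ε ≤ sectionErrorRate s (dec ω.1 (codeword P ω.1 s + ω.2))} =
      channelMeasure n L M σ (minEvent n P ε s) := by
  apply measure_eq_measure_of_null_sdiff
  · intro ω hω
    exact ⟨_, hω, fun t' => hdec ω.1 (codeword P ω.1 s + ω.2) t'⟩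
  · refine measure_mono_null (t := ⋃ t : Fin L → Fin M, ⋃ t' : Fin L → Fin M, ⋃ _ : t ≠ t',
      {ω : Design n L M × (Fin n → ℝ) |
        ∑ i, (codeword P ω.1 s i + ω.2 i - codeword P ω.1 t i) ^ 2 =
        ∑ i, (codeword P ω.1 s i + ω.2 i - codeword P ω.1 t' i) ^ 2}) ?_ ?_
    · rintro ω ⟨⟨t, ht, hmin⟩, hnot⟩
      simp only [Set.mem_iUnion]
      refine ⟨t, dec ω.1 (codeword P ω.1 s + ω.2), ?_,
        le_antisymm (hmin _) (hdec ω.1 (codeword P ω.1 s + ω.2) t)⟩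
      rintro rfl
      exact hnot ht
    · exact measure_iUnion_null fun t => measure_iUnion_null fun t' => measure_iUnion_null fun h =>
        tie_null hn hP hσ hL s t t' h

/-- Permute the columns within each section. -/
def permCols {L M : ℕ} (π : Fin L → Equiv.Perm (Fin M)) : Fin L × Fin M ≃ Fin L × Fin M :=
  Equiv.prodShear (Equiv.refl _) π

lemma measurePreserving_permCols {n L M : ℕ} (σ : ℝ) (π : Fin L → Equiv.Perm (Fin M)) :
    MeasurePreserving (fun ω : Design n L M × (Fin n → ℝ) => (fun i j => ω.1 i (permCols π j), ω.2))
      (channelMeasure n L M σ) (channelMeasure n L M σ) := by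
  have h1 : MeasurePreserving (fun (a : Fin L × Fin M → ℝ) j => a (permCols π j))
      (rowMeasure n L M) (rowMeasure n L M) :=
    measurePreserving_arrowCongr' (fun _ => gaussianReal 0 ((n : ℝ≥0)⁻¹))
      (fun _ => gaussianReal 0 ((n : ℝ≥0)⁻¹)) (permCols π).symm (MeasurableEquiv.refl ℝ)
      (fun _ => MeasurePreserving.id _)
  exact (measurePreserving_pi (fun _ : Fin n => rowMeasure n L M) (fun _ => rowMeasure n L M)
    fun _ => h1).prod (MeasurePreserving.id (noiseMeasure n σ))

lemma codeword_permCols {n L M : ℕ} (P : ℝ) (π : Fin L → Equiv.Perm (Fin M)) (A : Design n L M)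
    (t : Fin L → Fin M) :
    codeword P (fun i j => A i (permCols π j)) t = codeword P A (fun l => π l (t l)) := by
  funext i
  simp only [codeword, Matrix.mulVec, dotProduct, Matrix.of_apply]
  rw [← (permCols π).sum_comp (fun j => A i j * msgVec n P (fun l => π l (t l)) j)]
  refine Finset.sum_congr rfl fun j _ => ?_
  simp [msgVec, permCols, Equiv.prodShear]

lemma sectionErrorRate_perm {L M : ℕ} (π : Fin L → Equiv.Perm (Fin M)) (s t : Fin L → Fin M) :
    sectionErrorRate (fun l => π l (s l)) (fun l => π l (t l)) = sectionErrorRate s t := by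
  simp [sectionErrorRate]

/-- Swapping columns `s l` and `s' l` in every section preserves the law and exchanges the two
events. -/
lemma measure_minEvent_eq {n L M : ℕ} (P σ ε : ℝ) (s s' : Fin L → Fin M) :
    channelMeasure n L M σ (minEvent n P ε s) = channelMeasure n L M σ (minEvent n P ε s') := by
  set π : Fin L → Equiv.Perm (Fin M) := fun l => Equiv.swap (s l) (s' l) with hπ
  have hs : (fun l => π l (s l)) = s' := by funext l; simp [hπ]
  rw [← (measurePreserving_permCols σ π).measure_preimage
    (measurableSet_minEvent n P ε s).nullMeasurableSet]
  congr 1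
  ext ω
  simp only [minEvent, Set.mem_preimage, Set.mem_ofPred_eq, codeword_permCols, hs]
  constructor
  · rintro ⟨t, ht, h⟩
    refine ⟨fun l => π l (t l), by rw [← hs, sectionErrorRate_perm]; exact ht, fun t' => ?_⟩
    have := h (fun l => (π l).symm (t' l))
    simpa using this
  · rintro ⟨t, ht, h⟩
    refine ⟨fun l => (π l).symm (t l), ?_, fun t' => ?_⟩
    · rw [← sectionErrorRate_perm π, hs]
      simpa using ht
    · simpa using h (fun l => π l (t' l))

/-! ### Assembling the exponent and the concatenated code. -/

/-- At tilt `ρ` the linear term is at least `ρ²v`, while the logarithm costs at most `(8/15)ρ²v`.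
Positivity is needed to clear the denominator in `aStar`. -/
lemma D1_pos {x v ρ : ℝ} (hv0 : 0 < v) (hv1 : v < 1) (hρ0 : 0 < ρ) (hρ1 : ρ ≤ 1 / 4)
    (hx : ρ * v ≤ x) : 0 < D1 x v := by
  have hx0 : 0 < x := lt_of_lt_of_le (by positivity) hx
  have hbdd : BddAbove ((fun t : ℝ => t * x + (1 / 2) * Real.log (1 - t ^ 2 * v)) ''
      Set.Icc 0 1) := by
    refine ⟨x, ?_⟩
    rintro _ ⟨t, ⟨ht0, ht1⟩, rfl⟩
    have h1 := Real.log_nonpos (one_sub_sq_mul_pos ht0 ht1 hv0.le hv1).le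
      (by nlinarith [sq_nonneg t] : 1 - t ^ 2 * v ≤ 1)
    simp only
    nlinarith
  have hle : ρ * x + (1 / 2) * Real.log (1 - ρ ^ 2 * v) ≤ D1 x v :=
    le_csSup hbdd ⟨ρ, ⟨hρ0.le, by linarith⟩, rfl⟩
  have hp : ρ ^ 2 * v ≤ 1 / 16 := by nlinarith [sq_nonneg ρ]
  have hp0 : 0 < ρ ^ 2 * v := by positivity
  have h2 := log_gap (p := ρ ^ 2 * v) (q := 0) (by linarith) (by norm_num)
  rw [sub_zero, sub_zero, Real.log_one, zero_sub] at h2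
  have h3 : ρ ^ 2 * v / (1 - ρ ^ 2 * v) ≤ 16 / 15 * (ρ ^ 2 * v) := by
    rw [div_le_iff₀ (by linarith)]; nlinarith
  nlinarith

/-- The lower bound on the dictionary size controls the number of error patterns. -/
lemma log_choose_le_of_aStar_le {L M : ℕ} {n R s a : ℝ} (hs : 0 < s) (hL : 2 ≤ L)
    (hR0 : 0 < R) (hR : (L : ℝ) * Real.log M = n * R) (hMa : (M : ℝ) = (L : ℝ) ^ a)
    (ha : aStar L R s ≤ a) (j : ℕ) (hj1 : 1 ≤ j) (hjL : j ≤ L - 1) :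
    Real.log (L.choose j) ≤
      n * D1 (capAt s ((j : ℝ) / L) - (j : ℝ) / L * capacity s)
          ((j : ℝ) / L * (1 - (j : ℝ) / L) * s / (1 + (j : ℝ) / L * s)) := by
  have hL0 : (0 : ℝ) < L := by exact_mod_cast (by omega : 0 < L)
  have hj0 : (0 : ℝ) < j := by exact_mod_cast hj1
  have hlogL : 0 < Real.log L := Real.log_pos (by exact_mod_cast hL)
  have hlogM : Real.log M = a * Real.log L := by rw [hMa, Real.log_rpow hL0]
  have h := (le_csSup ((Set.finite_Icc 1 (L - 1)).image _).bddAbove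
    (Set.mem_image_of_mem (fun ℓ : ℕ => R * Real.log (L.choose ℓ) /
      (D1 (capAt s ((ℓ : ℝ) / L) - (ℓ : ℝ) / L * capacity s)
          ((ℓ : ℝ) / L * (1 - (ℓ : ℝ) / L) * s / (1 + (ℓ : ℝ) / L * s))
        * L * Real.log L)) (Set.mem_Icc.2 ⟨hj1, hjL⟩))).trans ha
  set α : ℝ := (j : ℝ) / L with hα
  have hα0 : 0 < α := by positivity
  have hα1 : α < 1 := by
    rw [hα, div_lt_one hL0]; exact_mod_cast (by omega : j < L)
  have hp : 0 < 1 + α * s := by positivity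
  have h1α : 0 < 1 - α := by linarith
  have hD := D1_pos (x := capAt s α - α * capacity s) (v := α * (1 - α) * s / (1 + α * s))
    (ρ := s / (4 * (1 + s))) (by positivity)
    (by rw [div_lt_one hp]; nlinarith [mul_pos hα0 hs, mul_pos hα0 (mul_pos hα0 hs)])
    (by positivity) (by rw [div_le_div_iff₀ (by positivity) (by norm_num)]; linarith)
    (capAt_sub_ge hs hα0.le hα1.le)
  generalize D1 (capAt s α - α * capacity s) (α * (1 - α) * s / (1 + α * s)) = D at *
  rw [div_le_iff₀ (by positivity)] at h
  have h2 : a * (D * L * Real.log L) = R * (n * D) := by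
    calc a * (D * L * Real.log L) = D * (L * Real.log M) := by rw [hlogM]; ring
      _ = R * (n * D) := by rw [hR]; ring
  rw [h2] at h
  exact le_of_mul_le_mul_left h hR0

/-- Since `ε > 0`, only the distances `1, …, L` matter; at most `L` terms of size `2 exp(-nh)` give
the prefactor `2L`. -/
lemma measure_sectionError_le {n L M : ℕ} {P σ R a ε : ℝ} (hn : 0 < n) (hP : 0 < P) (hσ : 0 < σ)
    (hL : 2 ≤ L) (hM : 0 < M) (hR0 : 0 < R) (hR : (L : ℝ) * Real.log M = n * R)
    (hRC : R < capacity (P / σ ^ 2)) (hMa : (M : ℝ) = (L : ℝ) ^ a)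
    (ha : aStar L R (P / σ ^ 2) ≤ a) (hε : 0 < ε)
    {dec : Design n L M → (Fin n → ℝ) → (Fin L → Fin M)} (hdec : IsOptimalDecoder P dec)
    (s : Fin L → Fin M) :
    channelMeasure n L M σ {ω | ε ≤ sectionErrorRate s (dec ω.1 (codeword P ω.1 s + ω.2))} ≤
      ENNReal.ofReal (2 * L *
        Real.exp (-(n * hFun (P / σ ^ 2) ε (capacity (P / σ ^ 2) - R)))) := by
  have hn0 : (0 : ℝ) < n := by exact_mod_cast hn
  have hL' : 0 < L := by omega
  have hL0 : (0 : ℝ) < L := by exact_mod_cast hL'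
  obtain ⟨S, hS⟩ : ∃ S, S = P / σ ^ 2 := ⟨_, rfl⟩
  rw [← hS] at hRC ha ⊢
  have hS0 : 0 < S := by rw [hS]; positivity
  have hΔ : 0 < capacity S - R := by linarith
  set h := hFun S ε (capacity S - R) with hh
  set K := (Finset.Icc 1 L).filter fun k : ℕ => ε ≤ (k : ℝ) / L with hK
  have hw0 : 0 ≤ wFun S := by unfold wFun; positivity
  have hbound : ∀ k ∈ K, channelMeasure n L M σ (errEvent n P s k) ≤
      ENNReal.ofReal (2 * Real.exp (-(n * h))) := by
    intro k hk
    obtain ⟨hk1, hk2⟩ := Finset.mem_filter.1 hk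
    obtain ⟨hk1, hkL⟩ := Finset.mem_Icc.1 hk1
    have h1 : h ≤ (k : ℝ) / L * (capacity S - R) * wFun S := by
      refine (min_le_left _ _).trans ?_
      gcongr
    have hx : capAt S ((k : ℝ) / L) - (k : ℝ) / L * capacity S + (k : ℝ) / L * (capacity S - R)
        = capAt S ((k : ℝ) / L) - (k : ℝ) / L * R := by ring
    rcases exists_exponent_bound hL hk1 hkL hS0 hn0 hΔ
      (log_choose_le_of_aStar_le hS0 hL hR0 hR hMa ha) rfl rfl h1 (min_le_right _ _) with
      ⟨t, ht0, ht1, ht⟩ | ⟨t, m, τ, ht0, ht1, hm0, hm1, ht⟩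
    · rw [hx] at ht
      exact (errEvent_le_untruncated hn hP.le hσ hL' hM hR s k ht0 ht1 rfl hS).trans
        (ENNReal.ofReal_le_ofReal ht)
    · rw [hx] at ht
      exact (errEvent_le_truncated hn hP.le hσ hL' hM hR s k hkL ht0 ht1 rfl hS hm0 hm1).trans
        (ENNReal.ofReal_le_ofReal ht)
  calc channelMeasure n L M σ {ω | ε ≤ sectionErrorRate s (dec ω.1 (codeword P ω.1 s + ω.2))}
      ≤ channelMeasure n L M σ (⋃ k ∈ K, errEvent n P s k) := by
        apply measure_mono
        intro ω hω
        have hω' : ε ≤ ((diffSet s (dec ω.1 (codeword P ω.1 s + ω.2))).card : ℝ) / L := hω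
        simp only [Set.mem_iUnion]
        refine ⟨_, Finset.mem_filter.2 ⟨Finset.mem_Icc.2 ⟨?_, ?_⟩, hω'⟩, _, rfl, ?_⟩
        · by_contra hcon
          rw [show (diffSet s (dec ω.1 (codeword P ω.1 s + ω.2))).card = 0 by omega] at hω'
          simp at hω'
          linarith
        · simpa using Finset.card_le_univ (diffSet s (dec ω.1 (codeword P ω.1 s + ω.2)))
        · simpa using hdec ω.1 (codeword P ω.1 s + ω.2) s
    _ ≤ ∑ k ∈ K, channelMeasure n L M σ (errEvent n P s k) := measure_biUnion_finset_le _ _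
    _ ≤ ∑ _k ∈ K, ENNReal.ofReal (2 * Real.exp (-(n * h))) := Finset.sum_le_sum hbound
    _ = (K.card : ℝ≥0∞) * ENNReal.ofReal (2 * Real.exp (-(n * h))) := by
        rw [Finset.sum_const, nsmul_eq_mul]
    _ ≤ (L : ℝ≥0∞) * ENNReal.ofReal (2 * Real.exp (-(n * h))) := by
        gcongr
        exact (Finset.card_filter_le _ _).trans (by simp)
    _ = _ := by
        rw [← ENNReal.ofReal_natCast, ← ENNReal.ofReal_mul (by positivity)]
        congr 1; ring

lemma excessErrorProb_eq {n L M : ℕ} {P σ : ℝ} (hn : 0 < n) (hP : 0 < P) (hσ : 0 < σ)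
    (hL : 0 < L) (hM : 0 < M) {dec : Design n L M → (Fin n → ℝ) → (Fin L → Fin M)}
    (hdec : IsOptimalDecoder P dec) (ε : ℝ) (s : Fin L → Fin M) :
    excessErrorProb P σ dec ε =
      channelMeasure n L M σ {ω | ε ≤ sectionErrorRate s (dec ω.1 (codeword P ω.1 s + ω.2))} := by
  have h : ∀ s' : Fin L → Fin M, channelMeasure n L M σ
      {ω | ε ≤ sectionErrorRate s' (dec ω.1 (codeword P ω.1 s' + ω.2))} =
      channelMeasure n L M σ
      {ω | ε ≤ sectionErrorRate s (dec ω.1 (codeword P ω.1 s + ω.2))} := fun s' => by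
    rw [measure_decoder_eq_minEvent hn hP hσ hL hdec, measure_decoder_eq_minEvent hn hP hσ hL hdec,
      measure_minEvent_eq P σ ε s' s]
  have hM0 : (M : ℝ≥0∞) ≠ 0 := by exact_mod_cast hM.ne'
  unfold excessErrorProb
  rw [Finset.sum_congr rfl fun s' _ => h s', Finset.sum_const, Finset.card_univ, nsmul_eq_mul]
  simp only [Fintype.card_fun, Fintype.card_fin, Nat.cast_pow]
  rw [mul_comm, ENNReal.mul_div_cancel_right (pow_ne_zero _ hM0)
    (ENNReal.pow_ne_top (ENNReal.natCast_ne_top M))]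

/-- With `d < εL` wrong sections and `K < L(1-2ε) + 1`, the integer `2d + K` is below `L + 1`, so
the outer decoder succeeds. -/
lemma messageErrorProb_le {F : Type*} [Field F] [Fintype F] [DecidableEq F] {n L M k : ℕ}
    {P σ ε : ℝ} (hn : 0 < n) (hP : 0 < P) (hσ : 0 < σ) (hL : 0 < L) (hM : 0 < M) (hLM : L ≤ M)
    (hk : k ≤ M) (hkε : k - (M - L) = 0 ∨ ((k - (M - L) : ℕ) : ℝ) < L * (1 - 2 * ε) + 1)
    {pts : Fin M → F} (hpts : Function.Injective pts) (lab : F ≃ Fin M)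
    {dec : Design n L M → (Fin n → ℝ) → (Fin L → Fin M)}
    {out : (Fin L → F) → (Fin (k - (M - L)) → F)} (hdec : IsOptimalDecoder P dec)
    (hout : IsMinDistDecoder (shortRS hLM hk pts) out) :
    messageErrorProb P σ lab (shortRS hLM hk pts) dec out ≤ excessErrorProb P σ dec ε := by
  have hL0 : (0 : ℝ) < L := by exact_mod_cast hL
  have h : ∀ v : Fin (k - (M - L)) → F, channelMeasure n L M σ
      {ω | out (fun ℓ => lab.symm (dec ω.1
        (codeword P ω.1 (fun ℓ' => lab (shortRS hLM hk pts v ℓ')) + ω.2) ℓ)) ≠ v} ≤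
      excessErrorProb P σ dec ε := by
    intro v
    rw [excessErrorProb_eq hn hP hσ hL hM hdec ε (fun ℓ' => lab (shortRS hLM hk pts v ℓ'))]
    apply measure_mono
    intro ω hω
    by_contra hcon
    refine hω (minDistDecoder_eq hLM hk hpts hout _ v (hkε.imp id fun hkε => ?_))
    simp only [Set.mem_ofPred_eq, not_le, sectionErrorRate] at hcon
    rw [div_lt_iff₀ hL0] at hcon
    set d := dec ω.1 (codeword P ω.1 (fun ℓ' => lab (shortRS hLM hk pts v ℓ')) + ω.2) with hd
    have hdist : hammingDist (fun ℓ => lab.symm (d ℓ)) (shortRS hLM hk pts v) =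
        (Finset.univ.filter fun ℓ => d ℓ ≠ lab (shortRS hLM hk pts v ℓ)).card := by
      unfold hammingDist
      congr 1
      ext ℓ
      simp [Equiv.symm_apply_eq]
    rw [hdist]
    have : ((2 * (Finset.univ.filter fun ℓ => d ℓ ≠ lab (shortRS hLM hk pts v ℓ)).card +
        (k - (M - L)) : ℕ) : ℝ) < (L + 1 : ℕ) := by
      push_cast at hkε ⊢
      linarith
    have := Nat.cast_lt.1 this
    omega
  unfold messageErrorProb
  apply ENNReal.div_le_of_le_mul
  refine (Finset.sum_le_sum fun v _ => h v).trans (le_of_eq ?_)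
  rw [Finset.sum_const, Finset.card_univ, nsmul_eq_mul, mul_comm]

lemma le_errorExponent {n L M : ℕ} (hn : 0 < n) {P σ : ℝ}
    {dec : Design n L M → (Fin n → ℝ) → (Fin L → Fin M)} {ε c h : ℝ} (hc : 0 < c)
    (hle : excessErrorProb P σ dec ε ≤ ENNReal.ofReal (c * Real.exp (-(n * h)))) :
    ((h - Real.log c / n : ℝ) : EReal) ≤ errorExponent P σ dec ε := by
  have hn0 : (0 : ℝ) < n := by exact_mod_cast hn
  unfold errorExponent
  rw [EReal.le_div_iff_mul_le (by exact_mod_cast hn) (EReal.natCast_ne_top n)]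
  have h1 := ENNReal.log_monotone hle
  rw [ENNReal.log_ofReal_of_pos (by positivity), Real.log_mul hc.ne' (Real.exp_pos _).ne',
    Real.log_exp] at h1
  have h2 : ((h - Real.log c / n : ℝ) : EReal) * (n : EReal)
      = -((Real.log c + -(n * h) : ℝ) : EReal) := by
    rw [← EReal.coe_natCast, ← EReal.coe_mul, ← EReal.coe_neg]
    congr 1
    field_simp
    ring
  rw [h2]
  exact EReal.neg_le_neg_iff.2 h1

end Sparc

end

theorem mainTheorem3 {F : Type*} [Field F] [Fintype F] [DecidableEq F]
    (n L M : ℕ) (P σ R a ε : ℝ) (hP : 0 < P) (hσ : 0 < σ)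
    (hM : Fintype.card F = M) (hLM : L ≤ M)
    (hR : (L : ℝ) * Real.log M = n * R)
    (hRC : R < Sparc.capacity (P / σ ^ 2))
    (hMa : (M : ℝ) = (L : ℝ) ^ a)
    (ha : Sparc.aStar L R (P / σ ^ 2) ≤ a)
    (hε : 0 < ε) :
    ∃ (k : ℕ) (hk : k ≤ M),
      R * (1 - 2 * ε) ≤ Sparc.codeRate F n (k - (M - L)) ∧
      Sparc.codeRate F n (k - (M - L)) ≤ max (R * (1 - 2 * ε)) 0 + R / L ∧
      ∀ (pts : Fin M ≃ F) (lab : F ≃ Fin M)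
        (dec : Sparc.Design n L M → (Fin n → ℝ) → (Fin L → Fin M))
        (out : (Fin L → F) → (Fin (k - (M - L)) → F)),
        Sparc.IsOptimalDecoder P dec →
        Sparc.IsMinDistDecoder (Sparc.shortRS hLM hk pts) out →
        Sparc.messageErrorProb P σ lab (Sparc.shortRS hLM hk pts) dec out ≤
            EReal.exp (-((n : EReal) * Sparc.errorExponent P σ dec ε)) ∧
          ((Sparc.hFun (P / σ ^ 2) ε (Sparc.capacity (P / σ ^ 2) - R)
              - Real.log (2 * L) / n : ℝ) : EReal) ≤ Sparc.errorExponent P σ dec ε := by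
  have hM2 : 1 < M := hM ▸ Fintype.one_lt_card
  have hM1 : (1 : ℝ) < M := by exact_mod_cast hM2
  have hlogM : 0 < Real.log M := Real.log_pos hM1
  -- `0^a` and `1^a` are at most 1, whereas a field has at least two elements.
  have hL : 2 ≤ L := by
    by_contra hcon
    interval_cases L
    · rw [Nat.cast_zero] at hMa
      linarith [Real.zero_rpow_le_one a]
    · rw [Nat.cast_one, Real.one_rpow] at hMa
      linarith
  have hL0 : (0 : ℝ) < L := by exact_mod_cast (by omega : 0 < L)
  have hn : 0 < n := by
    rcases Nat.eq_zero_or_pos n with rfl | hn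
    · rw [Nat.cast_zero, zero_mul] at hR
      exact absurd hR (mul_pos hL0 hlogM).ne'
    · exact hn
  have hn0 : (0 : ℝ) < n := by exact_mod_cast hn
  have hR0 : 0 < R := pos_of_mul_pos_right (hR ▸ mul_pos hL0 hlogM) hn0.le
  have hrate : ∀ K : ℕ, Sparc.codeRate F n K = K * (R / L) := fun K => by
    have h : (n : ℝ) * (R / L) = Real.log M := by
      rw [← mul_div_assoc, ← hR, mul_div_cancel_left₀ _ hL0.ne']
    rw [Sparc.codeRate, Fintype.card_fun, Fintype.card_fin, hM, Nat.cast_pow, Real.log_pow, ← h]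
    field_simp
  -- The least outer dimension reaching rate `R(1-2ε)`. For `ε ≥ 1/2` the natural-number ceiling is
  -- 0: there is one message and nothing to decode, whence the `max` with 0.
  set K := ⌈(L : ℝ) * (1 - 2 * ε)⌉₊ with hK
  have hKL : K ≤ L := Nat.ceil_le.2 (by nlinarith)
  have hK0 : K = 0 ∨ (K : ℝ) < L * (1 - 2 * ε) + 1 := by
    rcases le_or_gt 0 ((L : ℝ) * (1 - 2 * ε)) with h | h
    · exact Or.inr (Nat.ceil_lt_add_one h)
    · exact Or.inl (Nat.ceil_eq_zero.2 h.le)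
  have hRL : R * (1 - 2 * ε) = L * (1 - 2 * ε) * (R / L) := by field_simp
  have hRL0 : 0 < R / L := by positivity
  have hkK : M - L + K - (M - L) = K := by omega
  refine ⟨M - L + K, by omega, ?_, ?_, fun pts lab dec out hdec hout => ⟨?_, ?_⟩⟩
  · rw [hrate, hkK, hRL]
    exact mul_le_mul_of_nonneg_right (Nat.le_ceil _) hRL0.le
  · rw [hrate, hkK]
    rcases hK0 with h | h
    · rw [h, Nat.cast_zero, zero_mul]
      exact add_nonneg (le_max_right _ _) hRL0.le
    · refine le_trans ?_ (add_le_add_left (le_max_left _ _) _)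
      rw [hRL]
      nlinarith
  · rw [Sparc.exp_errorExponent hn.ne']
    exact Sparc.messageErrorProb_le hn hP hσ (by omega) (by omega) hLM _ (by rwa [hkK])
      pts.injective lab hdec hout
  · refine Sparc.le_errorExponent hn (by positivity) ?_
    rw [Sparc.excessErrorProb_eq hn hP hσ (by omega) (by omega) hdec ε
      (fun _ => (⟨0, by omega⟩ : Fin M))]
    exact Sparc.measure_sectionError_le hn hP hσ hL (by omega) hR0 hR hRC hMa ha hε hdec _
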